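/- Let $1\le m\le k\le N$ be integers and let $X_1,\dots,X_N$ be independent two-state Markov chains (channels) on $\{0,1\}$ in discrete time $t=1,2,\dots$, all with transition probabilities $p_{01}=P(0\to1)$ and $p_{11}=P(1\to1)$, where $0\le p_{01}\le p_{11}\le1$, and with independent initial states, $P(X_i(1)=1)=\omega_i(1)$. A policy $\pi$ is a sequence of maps $\pi(t)$ from belief vectors $\omega\in[0,1]^N$ to $k$-element subsets of $\{1,\dots,N\}$. At time $t$ the user senses the channels in $\pi(t)(\omega(t))$, observes their states and collects the reward $R_t=\min\{m,\#\{i\in\pi(t)(\omega(t)):X_i(t)=1\}\}$; the belief then becomes $\omega_i(t+1)=p_{11}$ (respectively $p_{01}$) if $i$ was sensed in state $1$ (respectively $0$), and $\omega_i(t+1)=\tau(\omega_i(t)):=\omega_i(t)p_{11}+(1-\omega_i(t))p_{01}$ if $i$ was not sensed. Problem (P2), for $0<\beta<1$, is to maximize $\mathbb E^\pi\big[\sum_{t\ge1}\beta^{t-1}R_t\mid\omega(1)=\omega\big]$ over all policies. Problem (P3) is to maximize $\mathbb E^\pi\big[\lim_{T\to\infty}\frac1T\sum_{t=1}^TR_t\mid\omega(1)=\omega\big]$,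 with $\limsup$ in place of $\lim$ for policies under which the limit fails to exist. A myopic policy always senses $k$ channels with the highest beliefs, ties being broken arbitrarily. For $v\in[0,1]^k$ let $r(v)=\mathbb E\min\{m,B_1+\dots+B_k\}$ with independent Bernoulli variables $B_j$ of parameters $v_j$, and let $$\overline{\mathcal R}=\max_{v\in[p_{01},p_{11}]^{k-1}}\{r(1,v)-r(0,v)\},\qquad \underline{\mathcal R}=\min_{v\in[p_{01},p_{11}]^{k-1}}\{r(1,v)-r(0,v)\}.$$ Let $\delta=p_{11}-p_{01}\ge0$, and suppose that $\delta<1$, $\overline{\mathcal R}>0$ and $$\frac{\delta}{1-\delta}<\frac{\underline{\mathcal R}}{\overline{\mathcal R}}.$$ Then every myopic policy is optimal for (P2), for every $0<\beta<1$ and every initial belief $\omega\in[p_{01},p_{11}]^N$. Every myopic policy is also optimal for (P3), for every initial belief $\omega\in[0,1]^N$; in particular, under it $\frac1T\sum_{t=1}^TR_t$ converges almost surely. -/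

import Mathlib

/-! ### The `(k, m)` sensing problem for `N` independent two-state Markov channels

`true` is the good state `1` and `false` the bad state `0`. Time is indexed from `0`, so index `t`
stands for the time step `t + 1` counted from `1`. `p01` and `p11` are the probabilities of moving
to state `1` from state `0` and from state `1`. -/

namespace ChannelSensing

noncomputable section

open MeasureTheory ProbabilityTheory Filter
open scoped unitInterval Topology

/-- One-step transition kernel of a channel. -/
def transition (p01 p11 : I) : Kernel Bool Bool :=
  Kernel.ofFunOfCountable fun b => bernoulliMeasure true false (if b then p11 else p01)

instance (p01 p11 : I) : IsMarkovKernel (transition p01 p11) :=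
  ⟨fun b => inferInstanceAs
    (IsProbabilityMeasure (bernoulliMeasure true false (if b then p11 else p01)))⟩

/-- Law of the trajectory of one channel that is initially in state `1` with probability `w`. -/
def chainLaw (p01 p11 w : I) : Measure (ℕ → Bool) :=
  Kernel.trajMeasure (X := fun _ => Bool) (bernoulliMeasure true false w)
    (fun n => (transition p01 p11).comap
      (fun h : (i : Finset.Iic n) → Bool => h ⟨n, Finset.mem_Iic.2 le_rfl⟩)
      (measurable_pi_apply _))

/-- Joint law of `N` independent channels, channel `i` being initially in state `1` with
probability `ω i`. The channels are uncontrolled, so this does not depend on the policy. -/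
def channelLaw {N : ℕ} (p01 p11 : I) (ω : Fin N → I) : Measure (Fin N → ℕ → Bool) :=
  Measure.pi fun i => chainLaw p01 p11 (ω i)

/-- A sensing policy: at each time, a map from belief vectors in `[0,1]^N` to sets of exactly `k`
channels. -/
abbrev Policy (N k : ℕ) : Type :=
  ℕ → (Fin N → I) → {s : Finset (Fin N) // s.card = k}

/-- The belief update `τ(w) = w p₁₁ + (1 - w) p₀₁` of a channel that is not sensed. -/
def tau (p01 p11 w : I) : I :=
  ⟨(w : ℝ) * p11 + (1 - w) * p01, by
    have h := convex_Icc (0 : ℝ) 1 p11.2 p01.2 w.2.1 (sub_nonneg.2 w.2.2) (by ring)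
    simpa [smul_eq_mul] using h⟩

/-- The belief vector at each time along the channel trajectories `x`, under policy `π` from the
initial belief `ω`. -/
def belief {N k : ℕ} (p01 p11 : I) (π : Policy N k) (ω : Fin N → I) (x : Fin N → ℕ → Bool) :
    ℕ → Fin N → I
  | 0 => ω
  | t + 1 => fun i =>
      if i ∈ (π t (belief p01 p11 π ω x t)).1 then (if x i t then p11 else p01)
      else tau p01 p11 (belief p01 p11 π ω x t i)

/-- The reward collected at each time along the trajectories `x`: one unit for every sensed channel
in state `1`, but at most `m` in total. -/
def reward {N k : ℕ} (m : ℕ) (p01 p11 : I) (π : Policy N k) (ω : Fin N → I)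
    (x : Fin N → ℕ → Bool) (t : ℕ) : ℝ :=
  ((min m ((π t (belief p01 p11 π ω x t)).1.filter fun i => x i t = true).card : ℕ) : ℝ)

/-- Expected total discounted reward of `π` from the initial belief `ω`. -/
def discountedValue {N k : ℕ} (m : ℕ) (p01 p11 : I) (β : ℝ) (π : Policy N k) (ω : Fin N → I) : ℝ :=
  ∫ x, ∑' t : ℕ, β ^ t * reward m p01 p11 π ω x t ∂(channelLaw p01 p11 ω)

/-- Average of the rewards of the first `T` steps along the trajectories `x`. -/
def timeAverage {N k : ℕ} (m : ℕ) (p01 p11 : I) (π : Policy N k) (ω : Fin N → I)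
    (x : Fin N → ℕ → Bool) (T : ℕ) : ℝ :=
  (1 / (T : ℝ)) * ∑ t ∈ Finset.range T, reward m p01 p11 π ω x t

/-- Expected long-run average reward of `π` from the initial belief `ω`; the upper limit is used so
that it makes sense for every policy. -/
def averageValue {N k : ℕ} (m : ℕ) (p01 p11 : I) (π : Policy N k) (ω : Fin N → I) : ℝ :=
  ∫ x, limsup (timeAverage m p01 p11 π ω x) atTop ∂(channelLaw p01 p11 ω)

/-- `π` is optimal for the infinite-horizon discounted problem started at `ω`. -/
def IsDiscountedOptimal {N k : ℕ} (m : ℕ) (p01 p11 : I) (β : ℝ) (π : Policy N k)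
    (ω : Fin N → I) : Prop :=
  ∀ π' : Policy N k, discountedValue m p01 p11 β π' ω ≤ discountedValue m p01 p11 β π ω

/-- `π` is optimal for the average-reward problem started at `ω`: under `π` the time averages of
the reward converge almost surely, and the expected limit is at least the expected upper limit of
the time averages under any other policy. -/
def IsAverageOptimal {N k : ℕ} (m : ℕ) (p01 p11 : I) (π : Policy N k) (ω : Fin N → I) : Prop :=
  (∀ᵐ x ∂(channelLaw p01 p11 ω), ∃ L : ℝ, Tendsto (timeAverage m p01 p11 π ω x) atTop (𝓝 L)) ∧
    ∀ π' : Policy N k, averageValue m p01 p11 π' ω ≤ averageValue m p01 p11 π ω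

/-- A myopic policy always senses `k` channels with the highest beliefs (ties broken in any way). -/
def IsMyopic {N k : ℕ} (π : Policy N k) : Prop :=
  ∀ (t : ℕ) (ω : Fin N → I), ∀ i ∈ (π t ω).1, ∀ j ∉ (π t ω).1, ω j ≤ ω i

/-- Expected one-step reward of sensing the set `s` when the belief vector is `ω`; the sum runs over
the set `g` of those sensed channels that are found in state `1`. -/
def expectedReward {N : ℕ} (m : ℕ) (s : Finset (Fin N)) (ω : Fin N → I) : ℝ :=
  ∑ g ∈ s.powerset, (∏ i ∈ g, (ω i : ℝ)) * (∏ i ∈ s \ g, (1 - (ω i : ℝ))) * ((min m g.card : ℕ) : ℝ)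

/-- The first `k` of the `N` channels. -/
def firstChannels (N k : ℕ) : Finset (Fin N) :=
  Finset.univ.filter fun i => i.val < k

/-- The differences in expected one-step reward, when the first `k` channels are sensed, between one
of them being surely in state `1` and surely in state `0`, the other beliefs lying in
`[p01, p11]`. By symmetry of the reward the choice of that channel is immaterial. -/
def marginalGains (N k m : ℕ) (p01 p11 : I) : Set ℝ :=
  {r | ∃ i ∈ firstChannels N k, ∃ ω : Fin N → I, (∀ j, ω j ∈ Set.Icc p01 p11) ∧
    r = expectedReward m (firstChannels N k) (Function.update ω i 1) -
      expectedReward m (firstChannels N k) (Function.update ω i 0)}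

/-- The largest marginal gain. -/
def Rmax (N k m : ℕ) (p01 p11 : I) : ℝ := sSup (marginalGains N k m p01 p11)

/-- The smallest marginal gain. -/
def Rmin (N k m : ℕ) (p01 p11 : I) : ℝ := sInf (marginalGains N k m p01 p11)

end

end ChannelSensing

/-! The myopic dynamics are encoded by ordered lists. Write `V n l` for `listValue … n l`: the first
`k` entries are sensed, then channels found good move to the front with belief `p11`, unsensed ones
keep their order, and channels found bad go to the back with belief `p01`. Since `tau` is increasing
with values in `[p01, p11]`, this rule keeps a decreasing list decreasing, so on sorted lists `V n`
is the `n`-step value of a myopic policy. It also makes sense on unsorted lists, and there an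
exchange argument can be run.

`V n` is affine in each entry, so exchanging beliefs `x ≥ y` changes it by `x - y` times the effect
of exchanging states `1` and `0` (`listValue_swap`). Two bounds are propagated together in the
horizon (`ExchangeBounds`): placing `1` just before `0` is never worse than the reverse, and placing
`1` anywhere before `0` gains at most `D`. One step turns states `1`, `0` into beliefs `p11`, `p01`,
so the future effect of an exchange is at most `δ D`. The upper bound survives because `D = Rmax /
(1 - δ)` solves `Rmax + δ D = D`. The adjacent bound is at risk only when the two channels lie on
either side of position `k`; the immediate gain is then at least `Rmin`, the future loss at most `δ
D`, and `δ D ≤ Rmin` follows from the hypothesis.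

Hence sorting does not decrease the value (`MyopicData.le_insertionSort`). Sensing a set `s` and
then continuing myopically is worth the list that puts `s` first, so the sorted value dominates
every choice and is attained by the myopic one: this is the Bellman equation. Letting the horizon
tend to infinity settles the discounted problem.

For the average reward, the same bounds at `β = 1` show that the sorted values at beliefs in `[p01,
p11]^N` lie within `N D` of a common constant, uniformly in the horizon. The mean of the values over
the horizons `0, …, n` therefore solves the average-reward optimality equation up to an error `O(1 /
n)`. A strong law for the centred one-step deviations turns this into almost sure bounds on time
averages that match as `n` grows, with no need for an exact solution of the equation. -/

namespace ChannelSensing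

noncomputable section

open MeasureTheory ProbabilityTheory Filter
open scoped unitInterval Topology

/-! ### Expectations of functions of a Poisson binomial variable -/

/-- Expectation of `F (B₁ + ⋯ + Bₙ)` for independent Bernoulli variables with parameters `l`. -/
def binExp : List ℝ → (ℕ → ℝ) → ℝ
  | [], F => F 0
  | x :: l, F => x * binExp l (fun j => F (j + 1)) + (1 - x) * binExp l F

theorem binExp_add (l : List ℝ) (F G : ℕ → ℝ) :
    binExp l (fun j => F j + G j) = binExp l F + binExp l G := by
  induction l generalizing F G with
  | nil => rfl
  | cons x l ih => simp only [binExp, ih]; ring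

theorem binExp_const_mul (l : List ℝ) (c : ℝ) (F : ℕ → ℝ) :
    binExp l (fun j => c * F j) = c * binExp l F := by
  induction l generalizing F with
  | nil => rfl
  | cons x l ih => simp only [binExp, ih]; ring

theorem binExp_sub (l : List ℝ) (F G : ℕ → ℝ) :
    binExp l (fun j => F j - G j) = binExp l F - binExp l G := by
  induction l generalizing F G with
  | nil => rfl
  | cons x l ih => simp only [binExp, ih]; ring

theorem binExp_const (l : List ℝ) (c : ℝ) : binExp l (fun _ => c) = c := by
  induction l with
  | nil => rfl
  | cons x l ih => simp only [binExp, ih]; ring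

/-- Only `j ≤ l.length` matters because the number of successes cannot exceed the number of
variables. Later uses need this to keep `k - j` free of truncation. -/
theorem binExp_mono {l : List ℝ} (hl : ∀ x ∈ l, x ∈ Set.Icc (0 : ℝ) 1) {F G : ℕ → ℝ}
    (h : ∀ j ≤ l.length, F j ≤ G j) : binExp l F ≤ binExp l G := by
  induction l generalizing F G with
  | nil => exact h 0 le_rfl
  | cons x l ih =>
    have hx := hl x (by simp)
    have hl' : ∀ x ∈ l, x ∈ Set.Icc (0 : ℝ) 1 := fun y hy => hl y (by simp [hy])
    exact add_le_add
      (mul_le_mul_of_nonneg_left (ih hl' fun j hj => h _ (by simp; omega)) hx.1)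
      (mul_le_mul_of_nonneg_left (ih hl' fun j hj => h _ (by simp; omega))
        (sub_nonneg.2 hx.2))

theorem binExp_perm {l l' : List ℝ} (h : l.Perm l') (F : ℕ → ℝ) : binExp l F = binExp l' F := by
  induction h generalizing F with
  | nil => rfl
  | cons x _ ih => simp only [binExp, ih]
  | swap x y l => simp only [binExp]; ring
  | trans _ _ ih₁ ih₂ => rw [ih₁, ih₂]

theorem binExp_middle (u v : List ℝ) (x : ℝ) (F : ℕ → ℝ) :
    binExp (u ++ x :: v) F =
      x * binExp (u ++ v) (fun j => F (j + 1)) + (1 - x) * binExp (u ++ v) F :=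
  binExp_perm List.perm_middle F

/-! ### The value of sensing the head of a list of beliefs -/

/-- The belief update of an unsensed channel on the reals. -/
def tauReal (p q x : ℝ) : ℝ := x * q + (1 - x) * p

/-- The list of beliefs after `j` of `k` sensed channels were found in state `1`, `l` being the
beliefs of the unsensed ones. -/
def nextList (k : ℕ) (p q : ℝ) (j : ℕ) (l : List ℝ) : List ℝ :=
  List.replicate j q ++ (l.map (tauReal p q) ++ List.replicate (k - j) p)

/-- Expected discounted reward over `n` steps when the first `k` channels of the list are sensed,
and the list is rearranged as in `nextList` after each step. -/
def listValue (k m : ℕ) (p q β : ℝ) : ℕ → List ℝ → ℝ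
  | 0, _ => 0
  | n + 1, l => binExp (l.take k) fun j =>
      ((min m j : ℕ) : ℝ) + β * listValue k m p q β n (nextList k p q j (l.drop k))

section ListValue

variable {k m : ℕ} {p q β : ℝ}

theorem tauReal_mem (hpq : p ≤ q) {x : ℝ} (hx : x ∈ Set.Icc (0 : ℝ) 1) :
    tauReal p q x ∈ Set.Icc p q := by
  obtain ⟨h0, h1⟩ := hx
  constructor <;> unfold tauReal <;> nlinarith

theorem listValue_append (n : ℕ) {u : List ℝ} (hu : u.length = k) (v : List ℝ) :
    listValue k m p q β (n + 1) (u ++ v) = binExp u fun j =>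
      ((min m j : ℕ) : ℝ) + β * listValue k m p q β n (nextList k p q j v) := by
  simp [listValue, ← hu]

/-- A sensed entry enters through a Bernoulli mixture and an unsensed one through `tauReal`, itself
affine; affinity thus passes from one horizon to the next. -/
theorem listValue_affine (n : ℕ) (u v : List ℝ) (x : ℝ) :
    listValue k m p q β n (u ++ x :: v) =
      x * listValue k m p q β n (u ++ 1 :: v) + (1 - x) * listValue k m p q β n (u ++ 0 :: v) := by
  induction n generalizing u v x with
  | zero => simp [listValue]
  | succ n ih =>
    simp only [listValue]
    rcases lt_or_ge u.length k with h | h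
    · have ht : ∀ y : ℝ, (u ++ y :: v).take k = u ++ y :: v.take (k - u.length - 1) := by
        intro y
        rw [List.take_append, List.take_of_length_le h.le]
        obtain ⟨c, hc⟩ : ∃ c, k - u.length = c + 1 := ⟨k - u.length - 1, by omega⟩
        simp [hc]
      have hd : ∀ y : ℝ, (u ++ y :: v).drop k = v.drop (k - u.length - 1) := by
        intro y
        rw [List.drop_append, List.drop_of_length_le h.le]
        obtain ⟨c, hc⟩ : ∃ c, k - u.length = c + 1 := ⟨k - u.length - 1, by omega⟩
        simp [hc]
      simp only [ht, hd, binExp_middle]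
      ring
    · have ht : ∀ y : ℝ, (u ++ y :: v).take k = u.take k := fun y => List.take_append_of_le_length h
      have hd : ∀ y : ℝ, (u ++ y :: v).drop k = u.drop k ++ y :: v :=
        fun y => List.drop_append_of_le_length h
      simp only [ht, hd]
      rw [← binExp_const_mul, ← binExp_const_mul, ← binExp_add]
      congr 1
      funext j
      have key : ∀ y : ℝ, nextList k p q j (u.drop k ++ y :: v) =
          (List.replicate j q ++ (u.drop k).map (tauReal p q)) ++ tauReal p q y ::
            (v.map (tauReal p q) ++ List.replicate (k - j) p) := by
        intro y; simp [nextList]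
      simp only [key]
      rw [ih _ _ (tauReal p q x), ih _ _ (tauReal p q 1), ih _ _ (tauReal p q 0)]
      unfold tauReal
      ring

/-- In the bilinear expansion over the two entries, the terms with equal states at both places
cancel. -/
theorem listValue_swap (n : ℕ) (u v w : List ℝ) (x y : ℝ) :
    listValue k m p q β n (u ++ x :: (v ++ y :: w)) -
        listValue k m p q β n (u ++ y :: (v ++ x :: w)) =
      (x - y) * (listValue k m p q β n (u ++ 1 :: (v ++ 0 :: w)) -
        listValue k m p q β n (u ++ 0 :: (v ++ 1 :: w))) := by
  have key : ∀ a b : ℝ, listValue k m p q β n (u ++ a :: (v ++ b :: w)) =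
      a * (b * listValue k m p q β n (u ++ 1 :: (v ++ 1 :: w)) +
        (1 - b) * listValue k m p q β n (u ++ 1 :: (v ++ 0 :: w))) +
      (1 - a) * (b * listValue k m p q β n (u ++ 0 :: (v ++ 1 :: w)) +
        (1 - b) * listValue k m p q β n (u ++ 0 :: (v ++ 0 :: w))) := by
    intro a b
    have h2 : ∀ c : ℝ, listValue k m p q β n (u ++ c :: (v ++ b :: w)) =
        b * listValue k m p q β n (u ++ c :: (v ++ 1 :: w)) +
        (1 - b) * listValue k m p q β n (u ++ c :: (v ++ 0 :: w)) := by
      intro c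
      simpa using listValue_affine (k := k) (m := m) (p := p) (q := q) (β := β) n (u ++ c :: v) w b
    rw [listValue_affine, h2 1, h2 0]
  rw [key x y, key y x]
  ring

/-- The properties of the `n`-step value that drive the induction: moving a channel in state `1`
one place forward does not hurt, and exchanging states `1` and `0` costs at most `D`. -/
structure ExchangeBounds (k m : ℕ) (p q β D : ℝ) (n : ℕ) : Prop where
  adjacent : ∀ u w : List ℝ, (∀ x ∈ u, x ∈ Set.Icc p q) → (∀ x ∈ w, x ∈ Set.Icc p q) →
    k ≤ u.length + w.length + 2 →
    listValue k m p q β n (u ++ 0 :: 1 :: w) ≤ listValue k m p q β n (u ++ 1 :: 0 :: w)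
  upper : ∀ u v w : List ℝ, (∀ x ∈ u, x ∈ Set.Icc p q) → (∀ x ∈ v, x ∈ Set.Icc p q) →
    (∀ x ∈ w, x ∈ Set.Icc p q) → k ≤ u.length + v.length + w.length + 2 →
    listValue k m p q β n (u ++ 1 :: (v ++ 0 :: w)) -
      listValue k m p q β n (u ++ 0 :: (v ++ 1 :: w)) ≤ D

namespace ExchangeBounds

variable {D : ℝ} {n : ℕ}

/-- By `listValue_swap` only the exchange of states `1` and `0` matters. The entries `x` and `y`
need not lie in `[p, q]`. The length condition, here and below, says that the list has at least `k`
channels. -/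
theorem swap_adjacent (H : ExchangeBounds k m p q β D n) {u w : List ℝ}
    (hu : ∀ x ∈ u, x ∈ Set.Icc p q) (hw : ∀ x ∈ w, x ∈ Set.Icc p q)
    (hk : k ≤ u.length + w.length + 2) {x y : ℝ} (hxy : y ≤ x) :
    listValue k m p q β n (u ++ y :: x :: w) ≤ listValue k m p q β n (u ++ x :: y :: w) := by
  have h := listValue_swap (k := k) (m := m) (p := p) (q := q) (β := β) n u [] w x y
  have h1 := H.adjacent u w hu hw hk
  simp only [List.nil_append] at h
  nlinarith [mul_nonneg (sub_nonneg.2 hxy) (sub_nonneg.2 h1)]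

/-- The entry `z` crosses only smaller ones, one `swap_adjacent` at a time. -/
theorem max_forward (H : ExchangeBounds k m p q β D n) {u v w : List ℝ}
    (hu : ∀ x ∈ u, x ∈ Set.Icc p q) (hv : ∀ x ∈ v, x ∈ Set.Icc p q)
    (hw : ∀ x ∈ w, x ∈ Set.Icc p q) {z : ℝ} (hzv : ∀ x ∈ v, x ≤ z)
    (hk : k ≤ u.length + v.length + w.length + 1) :
    listValue k m p q β n (u ++ (v ++ z :: w)) ≤ listValue k m p q β n (u ++ z :: (v ++ w)) := by
  induction v generalizing u with
  | nil => simp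
  | cons a v ih =>
    have ha : a ∈ Set.Icc p q := hv a (by simp)
    have hv' : ∀ x ∈ v, x ∈ Set.Icc p q := fun x hx => hv x (by simp [hx])
    have h1 := ih (u := u ++ [a])
      (List.forall_mem_append.2 ⟨hu, List.forall_mem_singleton.2 ha⟩) hv'
      (fun x hx => hzv x (by simp [hx])) (by simp at hk ⊢; omega)
    have h2 := H.swap_adjacent (u := u) (w := v ++ w) hu
      (List.forall_mem_append.2 ⟨hv', hw⟩) (by simp at hk ⊢; omega)
      (hzv a (by simp))
    simp only [List.append_assoc, List.cons_append, List.nil_append] at h1 h2 ⊢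
    exact h1.trans h2

theorem min_backward (H : ExchangeBounds k m p q β D n) {u v w : List ℝ}
    (hu : ∀ x ∈ u, x ∈ Set.Icc p q) (hv : ∀ x ∈ v, x ∈ Set.Icc p q)
    (hw : ∀ x ∈ w, x ∈ Set.Icc p q) {z : ℝ} (hzv : ∀ x ∈ v, z ≤ x)
    (hk : k ≤ u.length + v.length + w.length + 1) :
    listValue k m p q β n (u ++ z :: (v ++ w)) ≤ listValue k m p q β n (u ++ (v ++ z :: w)) := by
  induction v generalizing u with
  | nil => simp
  | cons a v ih =>
    have ha : a ∈ Set.Icc p q := hv a (by simp)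
    have hv' : ∀ x ∈ v, x ∈ Set.Icc p q := fun x hx => hv x (by simp [hx])
    have h1 := ih (u := u ++ [a])
      (List.forall_mem_append.2 ⟨hu, List.forall_mem_singleton.2 ha⟩) hv'
      (fun x hx => hzv x (by simp [hx])) (by simp at hk ⊢; omega)
    have h2 := H.swap_adjacent (u := u) (w := v ++ w) hu
      (List.forall_mem_append.2 ⟨hv', hw⟩) (by simp at hk ⊢; omega)
      (hzv a (by simp))
    simp only [List.append_assoc, List.cons_append, List.nil_append] at h1 h2 ⊢
    exact h2.trans h1

/-- Exchanging two beliefs `x ≥ y` of `[p, q]` costs at most `(q - p) D`. -/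
theorem swap_le (H : ExchangeBounds k m p q β D n) (hD : 0 ≤ D) {u v w : List ℝ}
    (hu : ∀ x ∈ u, x ∈ Set.Icc p q) (hv : ∀ x ∈ v, x ∈ Set.Icc p q)
    (hw : ∀ x ∈ w, x ∈ Set.Icc p q) (hk : k ≤ u.length + v.length + w.length + 2)
    {x y : ℝ} (hy : p ≤ y) (hxy : y ≤ x) (hx : x ≤ q) :
    listValue k m p q β n (u ++ x :: (v ++ y :: w)) -
      listValue k m p q β n (u ++ y :: (v ++ x :: w)) ≤ (q - p) * D := by
  rw [listValue_swap]
  have h := H.upper u v w hu hv hw hk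
  calc _ ≤ (x - y) * D := mul_le_mul_of_nonneg_left h (sub_nonneg.2 hxy)
    _ ≤ (q - p) * D := mul_le_mul_of_nonneg_right (by linarith) hD

/-- Postponing a channel with the lowest belief gains at most `(q - p) D`. -/
theorem postpone_le (H : ExchangeBounds k m p q β D n) (hpq : p ≤ q) (hD : 0 ≤ D)
    {u v w : List ℝ}
    (hu : ∀ x ∈ u, x ∈ Set.Icc p q) (hv : ∀ x ∈ v, x ∈ Set.Icc p q)
    (hw : ∀ x ∈ w, x ∈ Set.Icc p q) (hk : k ≤ u.length + v.length + w.length + 1) :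
    listValue k m p q β n (u ++ (v ++ p :: w)) -
      listValue k m p q β n (u ++ p :: (v ++ w)) ≤ (q - p) * D := by
  rcases eq_or_ne v [] with rfl | hne
  · simpa using mul_nonneg (sub_nonneg.2 hpq) hD
  obtain ⟨z, hz, hmax⟩ := v.toFinset.exists_max_image id
    (by simpa [Finset.nonempty_iff_ne_empty] using hne)
  simp only [List.mem_toFinset, id] at hz hmax
  -- Crossing `v` entry by entry would cost a multiple of its length. Instead the largest entry `z`
  -- is moved for free to the front of `v`, exchanged once with `p`, and moved for free back to its
  -- place.
  obtain ⟨v₁, v₂, rfl⟩ := List.append_of_mem hz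
  have hz' := hv z hz
  have hv₁ : ∀ x ∈ v₁, x ∈ Set.Icc p q := fun x hx => hv x (by simp [hx])
  have hv₂ : ∀ x ∈ v₂, x ∈ Set.Icc p q := fun x hx => hv x (by simp [hx])
  have hpp : p ∈ Set.Icc p q := ⟨le_rfl, hpq⟩
  simp only [List.length_append, List.length_cons] at hk
  have h1 := H.max_forward (u := u) (v := v₁) (w := v₂ ++ p :: w) (z := z) hu hv₁
    (List.forall_mem_append.2 ⟨hv₂, List.forall_mem_cons.2 ⟨hpp, hw⟩⟩)
    (fun x hx => hmax x (by simp [hx])) (by simp; omega)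
  have h2 := H.max_forward (u := u ++ p :: v₁) (v := v₂) (w := w) (z := z)
    (List.forall_mem_append.2 ⟨hu, List.forall_mem_cons.2 ⟨hpp, hv₁⟩⟩)
    hv₂ hw (fun x hx => hmax x (by simp [hx])) (by simp; omega)
  have h3 := H.swap_le hD (u := u) (v := v₁ ++ v₂) (w := w) hu
    (List.forall_mem_append.2 ⟨hv₁, hv₂⟩) hw
    (by simp; omega) (x := z) (y := p) le_rfl hz'.1 hz'.2
  simp only [List.append_assoc, List.cons_append] at h1 h2 h3 ⊢
  linarith

end ExchangeBounds

end ListValue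

/-! ### Exchange bounds and slopes by induction on the horizon -/

section ListValueInduction

variable {k m : ℕ} {p q β D r R : ℝ}

theorem forall_mem_replicate_Icc {x : ℝ} (hx : x ∈ Set.Icc p q) (j : ℕ) :
    ∀ y ∈ List.replicate j x, y ∈ Set.Icc p q := by
  intro y hy
  rw [List.eq_of_mem_replicate hy]
  exact hx

theorem forall_mem_map_tauReal (hp : 0 ≤ p) (hpq : p ≤ q) (hq : q ≤ 1) {l : List ℝ}
    (hl : ∀ x ∈ l, x ∈ Set.Icc p q) : ∀ y ∈ l.map (tauReal p q), y ∈ Set.Icc p q := by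
  intro y hy
  obtain ⟨x, hx, rfl⟩ := List.mem_map.1 hy
  exact tauReal_mem hpq ⟨hp.trans (hl x hx).1, (hl x hx).2.trans hq⟩

theorem forall_mem_unit_of_Icc (hp : 0 ≤ p) (hq : q ≤ 1) {l : List ℝ}
    (hl : ∀ x ∈ l, x ∈ Set.Icc p q) : ∀ x ∈ l, x ∈ Set.Icc (0 : ℝ) 1 :=
  fun x hx => ⟨hp.trans (hl x hx).1, (hl x hx).2.trans hq⟩

theorem exists_append_of_le_length {l : List ℝ} (h : k ≤ l.length) :
    ∃ u v, l = u ++ v ∧ u.length = k :=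
  ⟨l.take k, l.drop k, (List.take_append_drop k l).symm, by simpa using h⟩

/-- Marginal gains of the one-step reward lie between `r` and `R`. -/
def GainBounds (k m : ℕ) (p q r R : ℝ) : Prop :=
  ∀ u : List ℝ, (∀ x ∈ u, x ∈ Set.Icc p q) → u.length + 1 = k →
    binExp u (fun j => ((min m (j + 1) : ℕ) : ℝ) - ((min m j : ℕ) : ℝ)) ∈ Set.Icc r R

theorem nextList_cons_zero (j : ℕ) (w : List ℝ) :
    nextList k p q j (0 :: w) =
      List.replicate j q ++ p :: (w.map (tauReal p q) ++ List.replicate (k - j) p) := by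
  simp [nextList, tauReal]

theorem nextList_append_cons (j : ℕ) (v w : List ℝ) (x : ℝ) :
    nextList k p q j (v ++ x :: w) =
      (List.replicate j q ++ v.map (tauReal p q)) ++ tauReal p q x ::
        (w.map (tauReal p q) ++ List.replicate (k - j) p) := by
  simp [nextList]

theorem tauReal_zero : tauReal p q 0 = p := by simp [tauReal]

theorem tauReal_one : tauReal p q 1 = q := by simp [tauReal]

theorem exchangeBounds_zero (hD : 0 ≤ D) : ExchangeBounds k m p q β D 0 :=
  ⟨fun _ _ _ _ _ => le_rfl, fun _ _ _ _ _ _ _ => by simpa [listValue] using hD⟩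

theorem replicate_sub_succ {j : ℕ} (hj : j + 1 ≤ k) (x : ℝ) :
    List.replicate (k - j) x = x :: List.replicate (k - (j + 1)) x := by
  rw [← List.replicate_succ]; congr 1; omega

/-- If both channels are sensed, the order is irrelevant; if neither is, they become adjacent
beliefs `p`, `q` and the bound at horizon `n` applies. On the boundary the reward gain is at least
`r`, and the future loss at most `(q - p) * D ≤ r`. -/
theorem ExchangeBounds.adjacent_succ {n : ℕ} (hp : 0 ≤ p) (hpq : p ≤ q) (hq : q ≤ 1)
    (hβ : 0 ≤ β) (hβ1 : β ≤ 1) (hD : 0 ≤ D) (hrD : (q - p) * D ≤ r)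
    (hg : GainBounds k m p q r R) (H : ExchangeBounds k m p q β D n) (u w : List ℝ)
    (hu : ∀ x ∈ u, x ∈ Set.Icc p q) (hw : ∀ x ∈ w, x ∈ Set.Icc p q)
    (hk : k ≤ u.length + w.length + 2) :
    listValue k m p q β (n + 1) (u ++ 0 :: 1 :: w) ≤
      listValue k m p q β (n + 1) (u ++ 1 :: 0 :: w) := by
  have hpp : p ∈ Set.Icc p q := ⟨le_rfl, hpq⟩
  have hqq : q ∈ Set.Icc p q := ⟨hpq, le_rfl⟩
  rcases le_or_gt k u.length with h | h
  · obtain ⟨t, u, rfl, rfl⟩ := exists_append_of_le_length h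
    obtain ⟨ht, hu⟩ := List.forall_mem_append.1 hu
    rw [List.append_assoc, List.append_assoc, listValue_append n rfl, listValue_append n rfl]
    refine binExp_mono (forall_mem_unit_of_Icc hp hq ht) fun j hj => ?_
    gcongr
    rw [nextList_append_cons, nextList_append_cons, tauReal_zero, tauReal_one]
    simp only [List.map_cons, tauReal_zero, tauReal_one, List.cons_append]
    refine H.swap_adjacent ?_ ?_ ?_ hpq
    · exact List.forall_mem_append.2 ⟨forall_mem_replicate_Icc hqq j,
        forall_mem_map_tauReal hp hpq hq hu⟩
    · exact List.forall_mem_append.2 ⟨forall_mem_map_tauReal hp hpq hq hw,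
        forall_mem_replicate_Icc hpp _⟩
    · simp; omega
  · rcases Nat.lt_or_ge (u.length + 1) k with h2 | h2
    · obtain ⟨t, w, rfl, ht⟩ := exists_append_of_le_length (k := k - (u.length + 2)) (l := w)
        (by omega)
      have e : ∀ a b : ℝ, u ++ a :: b :: (t ++ w) = (u ++ a :: b :: t) ++ w := by simp
      rw [e, e, listValue_append n (by simp; omega), listValue_append n (by simp; omega)]
      exact (binExp_perm (List.Perm.append_left u (List.Perm.swap _ _ _)) _).le
    · have e : ∀ a b : ℝ, u ++ a :: b :: w = (u ++ [a]) ++ b :: w := by simp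
      rw [e, e, listValue_append n (by simp; omega), listValue_append n (by simp; omega),
        binExp_middle, binExp_middle]
      simp only [List.append_nil, zero_mul, one_mul, sub_zero, sub_self, zero_add, add_zero]
      have hgu := (hg u hu (by omega)).1
      rw [binExp_sub] at hgu
      have hloss : binExp u (fun j => β * listValue k m p q β n (nextList k p q j (1 :: w))) -
          binExp u (fun j => β * listValue k m p q β n (nextList k p q (j + 1) (0 :: w))) ≤
          (q - p) * D := by
        rw [← binExp_sub, ← binExp_const u ((q - p) * D)]
        refine binExp_mono (forall_mem_unit_of_Icc hp hq hu) fun j hj => ?_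
        have h1 := H.postpone_le hpq hD (u := List.replicate (j + 1) q)
          (v := w.map (tauReal p q)) (w := List.replicate (k - (j + 1)) p)
          (forall_mem_replicate_Icc hqq _) (forall_mem_map_tauReal hp hpq hq hw)
          (forall_mem_replicate_Icc hpp _) (by simp; omega)
        have h0 : 0 ≤ (q - p) * D := mul_nonneg (sub_nonneg.2 hpq) hD
        -- The unsensed good channel heads the unsensed block and joins the `q`'s, so both
        -- continuations start with `j + 1` of them. They differ only in the place of one `p`,
        -- before or after `w`.
        have e1 : nextList k p q j (1 :: w) = List.replicate (j + 1) q ++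
            (w.map (tauReal p q) ++ p :: List.replicate (k - (j + 1)) p) := by
          rw [← replicate_sub_succ (by omega)]
          simp [nextList, tauReal_one, List.replicate_succ']
        rw [e1, nextList_cons_zero, ← mul_sub]
        calc _ ≤ β * ((q - p) * D) := mul_le_mul_of_nonneg_left h1 hβ
          _ ≤ _ := by nlinarith
      rw [binExp_add, binExp_add]
      linarith

/-- The same three cases as for the adjacent bound. In the boundary case the gain is at most `R` now
and `(q - p) * D` later, which `hRD` bounds by `D`. -/
theorem ExchangeBounds.upper_succ {n : ℕ} (hp : 0 ≤ p) (hpq : p ≤ q) (hq : q ≤ 1)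
    (hβ : 0 ≤ β) (hβ1 : β ≤ 1) (hD : 0 ≤ D) (hR : 0 ≤ R) (hRD : R + (q - p) * D ≤ D)
    (hg : GainBounds k m p q r R) (H : ExchangeBounds k m p q β D n) (u v w : List ℝ)
    (hu : ∀ x ∈ u, x ∈ Set.Icc p q) (hv : ∀ x ∈ v, x ∈ Set.Icc p q)
    (hw : ∀ x ∈ w, x ∈ Set.Icc p q) (hk : k ≤ u.length + v.length + w.length + 2) :
    listValue k m p q β (n + 1) (u ++ 1 :: (v ++ 0 :: w)) -
      listValue k m p q β (n + 1) (u ++ 0 :: (v ++ 1 :: w)) ≤ D := by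
  have hpp : p ∈ Set.Icc p q := ⟨le_rfl, hpq⟩
  have hqq : q ∈ Set.Icc p q := ⟨hpq, le_rfl⟩
  have h0 : 0 ≤ (q - p) * D := mul_nonneg (sub_nonneg.2 hpq) hD
  have hβD : β * ((q - p) * D) ≤ (q - p) * D := by nlinarith
  rcases le_or_gt k u.length with h | h
  · obtain ⟨t, u, rfl, rfl⟩ := exists_append_of_le_length h
    obtain ⟨ht, hu⟩ := List.forall_mem_append.1 hu
    rw [List.append_assoc, List.append_assoc, listValue_append n rfl, listValue_append n rfl,
      ← binExp_sub, ← binExp_const t D]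
    refine binExp_mono (forall_mem_unit_of_Icc hp hq ht) fun j hj => ?_
    have h1 := H.swap_le hD (u := List.replicate j q ++ u.map (tauReal p q))
      (v := v.map (tauReal p q)) (w := w.map (tauReal p q) ++ List.replicate (t.length - j) p)
      (List.forall_mem_append.2 ⟨forall_mem_replicate_Icc hqq j,
        forall_mem_map_tauReal hp hpq hq hu⟩) (forall_mem_map_tauReal hp hpq hq hv)
      (List.forall_mem_append.2 ⟨forall_mem_map_tauReal hp hpq hq hw,
        forall_mem_replicate_Icc hpp _⟩) (by simp; omega) (x := q) (y := p) le_rfl hpq le_rfl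
    have e : ∀ a b : ℝ, nextList t.length p q j (u ++ a :: (v ++ b :: w)) =
        (List.replicate j q ++ u.map (tauReal p q)) ++ tauReal p q a :: (v.map (tauReal p q) ++
          tauReal p q b :: (w.map (tauReal p q) ++ List.replicate (t.length - j) p)) := by
      simp [nextList]
    rw [e, e, tauReal_zero, tauReal_one]
    have := mul_le_mul_of_nonneg_left h1 hβ
    linarith
  · rcases Nat.lt_or_ge (u.length + v.length + 1) k with h2 | h2
    · obtain ⟨t, w, rfl, ht⟩ := exists_append_of_le_length
        (k := k - (u.length + v.length + 2)) (l := w) (by omega)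
      have e : ∀ a b : ℝ, u ++ a :: (v ++ b :: (t ++ w)) = (u ++ a :: (v ++ b :: t)) ++ w := by
        simp
      rw [e, e, listValue_append n (by simp; omega), listValue_append n (by simp; omega)]
      have hperm : (u ++ (1 : ℝ) :: (v ++ 0 :: t)).Perm (u ++ 0 :: (v ++ 1 :: t)) := by
        refine List.Perm.append_left u ?_
        calc (1 :: (v ++ 0 :: t) : List ℝ).Perm (1 :: 0 :: (v ++ t)) :=
              List.Perm.cons _ List.perm_middle
          _ |>.Perm (0 :: 1 :: (v ++ t)) := List.Perm.swap _ _ _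
          _ |>.Perm (0 :: (v ++ 1 :: t)) := List.Perm.cons _ List.perm_middle.symm
      rw [binExp_perm hperm, sub_self]
      exact hD
    · obtain ⟨t, v, rfl, ht⟩ := exists_append_of_le_length (k := k - (u.length + 1)) (l := v)
        (by omega)
      obtain ⟨htt, hv⟩ := List.forall_mem_append.1 hv
      have e : ∀ a b : ℝ, u ++ a :: ((t ++ v) ++ b :: w) = (u ++ a :: t) ++ (v ++ b :: w) := by
        simp
      rw [e, e, listValue_append n (by simp; omega), listValue_append n (by simp; omega),
        binExp_middle, binExp_middle]
      simp only [zero_mul, one_mul, sub_zero, sub_self, zero_add, add_zero]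
      have hut := List.forall_mem_append.2 ⟨hu, htt⟩
      have hlen : (u ++ t).length + 1 = k := by simp; omega
      have hgu := (hg (u ++ t) hut hlen).2
      rw [binExp_sub] at hgu
      have hgain : binExp (u ++ t)
            (fun j => β * listValue k m p q β n (nextList k p q (j + 1) (v ++ 0 :: w))) -
          binExp (u ++ t)
            (fun j => β * listValue k m p q β n (nextList k p q j (v ++ 1 :: w))) ≤
          (q - p) * D := by
        rw [← binExp_sub, ← binExp_const (u ++ t) ((q - p) * D)]
        refine binExp_mono (forall_mem_unit_of_Icc hp hq hut) fun j hj => ?_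
        have hv' := forall_mem_map_tauReal hp hpq hq hv
        have hw' := forall_mem_map_tauReal hp hpq hq hw
        have hl := forall_mem_replicate_Icc hpp (k - (j + 1))
        have hj' := forall_mem_replicate_Icc hqq j
        have h1 := H.swap_le hD (u := List.replicate j q)
          (v := v.map (tauReal p q)) (w := w.map (tauReal p q) ++ List.replicate (k - (j + 1)) p)
          hj' hv' (List.forall_mem_append.2 ⟨hw', hl⟩) (by simp; omega)
          (x := q) (y := p) le_rfl hpq le_rfl
        have hvw := List.forall_mem_append.2 ⟨hv', List.forall_mem_cons.2 ⟨hqq, hw'⟩⟩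
        -- After the exchange of `q` and `p` in `h1`, the second list has `p` in front of the
        -- unsensed block, whereas the true continuation has it behind; moving it back does not
        -- decrease the value.
        have h2 := H.min_backward (u := List.replicate j q)
          (v := v.map (tauReal p q) ++ q :: w.map (tauReal p q))
          (w := List.replicate (k - (j + 1)) p) hj' hvw hl (z := p) (fun x hx => (hvw x hx).1)
          (by simp; omega)
        have e1 : nextList k p q (j + 1) (v ++ 0 :: w) = List.replicate j q ++ q ::
            (v.map (tauReal p q) ++ p :: (w.map (tauReal p q) ++
              List.replicate (k - (j + 1)) p)) := by
          simp [nextList, tauReal_zero, List.replicate_succ']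
        have e2 : nextList k p q j (v ++ 1 :: w) = List.replicate j q ++
            ((v.map (tauReal p q) ++ q :: w.map (tauReal p q)) ++ p ::
              List.replicate (k - (j + 1)) p) := by
          rw [← replicate_sub_succ (by simp at hlen; simp at hj; omega)]
          simp [nextList, tauReal_one]
        rw [e1, e2, ← mul_sub]
        simp only [List.append_assoc, List.cons_append] at h1 h2 ⊢
        calc _ ≤ β * ((q - p) * D) := mul_le_mul_of_nonneg_left (by linarith) hβ
          _ ≤ _ := hβD
      rw [binExp_add, binExp_add]
      linarith

/-- Data under which the myopic order of the channels is optimal. -/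
structure MyopicData (k m : ℕ) (p q β r R D : ℝ) : Prop where
  hp : 0 ≤ p
  hpq : p ≤ q
  hq : q ≤ 1
  hβ : 0 ≤ β
  hβ1 : β ≤ 1
  hD : 0 ≤ D
  hR : 0 ≤ R
  hrD : (q - p) * D ≤ r
  hRD : R + (q - p) * D ≤ D
  gain : GainBounds k m p q r R

namespace MyopicData

theorem exchangeBounds (h : MyopicData k m p q β r R D) (n : ℕ) :
    ExchangeBounds k m p q β D n := by
  induction n with
  | zero => exact exchangeBounds_zero h.hD
  | succ n ih =>
    exact ⟨ih.adjacent_succ h.hp h.hpq h.hq h.hβ h.hβ1 h.hD h.hrD h.gain,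
      ih.upper_succ h.hp h.hpq h.hq h.hβ h.hβ1 h.hD h.hR h.hRD h.gain⟩

/-- The value is nondecreasing in each belief, with slope at most `D`. -/
theorem slope_mem (h : MyopicData k m p q β r R D) (n : ℕ) {u v : List ℝ}
    (hu : ∀ x ∈ u, x ∈ Set.Icc p q) (hv : ∀ x ∈ v, x ∈ Set.Icc p q)
    (hk : k ≤ u.length + v.length + 1) :
    listValue k m p q β n (u ++ 1 :: v) - listValue k m p q β n (u ++ 0 :: v) ∈
      Set.Icc 0 D := by
  obtain ⟨hp, hpq, hq, hβ, hβ1, hD, hR, hrD, hRD, hg⟩ := id h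
  have hpp : p ∈ Set.Icc p q := ⟨le_rfl, hpq⟩
  have hqq : q ∈ Set.Icc p q := ⟨hpq, le_rfl⟩
  have h0 : 0 ≤ (q - p) * D := mul_nonneg (sub_nonneg.2 hpq) hD
  have hβD : β * ((q - p) * D) ≤ (q - p) * D := by nlinarith
  induction n generalizing u v with
  | zero => simpa [listValue] using hD
  | succ n ih =>
    have H := h.exchangeBounds n
    have hstep : ∀ {u v : List ℝ}, (∀ x ∈ u, x ∈ Set.Icc p q) → (∀ x ∈ v, x ∈ Set.Icc p q) →
        k ≤ u.length + v.length + 1 →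
        listValue k m p q β n (u ++ q :: v) - listValue k m p q β n (u ++ p :: v) ∈
          Set.Icc 0 ((q - p) * D) := by
      intro u v hu hv hk
      obtain ⟨h1, h2⟩ := ih hu hv hk
      rw [listValue_affine n u v q, listValue_affine n u v p]
      have e : q * listValue k m p q β n (u ++ 1 :: v) +
          (1 - q) * listValue k m p q β n (u ++ 0 :: v) -
          (p * listValue k m p q β n (u ++ 1 :: v) +
          (1 - p) * listValue k m p q β n (u ++ 0 :: v)) = (q - p) *
          (listValue k m p q β n (u ++ 1 :: v) - listValue k m p q β n (u ++ 0 :: v)) := by ring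
      rw [e]
      exact ⟨mul_nonneg (sub_nonneg.2 hpq) h1, mul_le_mul_of_nonneg_left h2 (sub_nonneg.2 hpq)⟩
    rcases le_or_gt k u.length with hku | hku
    · obtain ⟨t, u, rfl, rfl⟩ := exists_append_of_le_length hku
      obtain ⟨ht, hu⟩ := List.forall_mem_append.1 hu
      rw [List.append_assoc, List.append_assoc, listValue_append n rfl, listValue_append n rfl,
        ← binExp_sub]
      have key : ∀ j ≤ t.length, ((min m j : ℕ) : ℝ) +
            β * listValue t.length m p q β n (nextList t.length p q j (u ++ 1 :: v)) -
          (((min m j : ℕ) : ℝ) +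
            β * listValue t.length m p q β n (nextList t.length p q j (u ++ 0 :: v))) ∈
          Set.Icc 0 D := by
        intro j hj
        rw [nextList_append_cons, nextList_append_cons, tauReal_zero, tauReal_one]
        obtain ⟨h1, h2⟩ := hstep (u := List.replicate j q ++ u.map (tauReal p q))
          (v := v.map (tauReal p q) ++ List.replicate (t.length - j) p)
          (List.forall_mem_append.2 ⟨forall_mem_replicate_Icc hqq j,
            forall_mem_map_tauReal hp hpq hq hu⟩)
          (List.forall_mem_append.2 ⟨forall_mem_map_tauReal hp hpq hq hv,
            forall_mem_replicate_Icc hpp _⟩) (by simp; omega)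
        have h3 := mul_le_mul_of_nonneg_left h2 hβ
        have h4 := mul_nonneg hβ h1
        constructor <;> linarith
      have hunit := forall_mem_unit_of_Icc hp hq ht
      constructor
      · conv_lhs => rw [← binExp_const t 0]
        exact binExp_mono hunit fun j hj => (key j hj).1
      · conv_rhs => rw [← binExp_const t D]
        exact binExp_mono hunit fun j hj => (key j hj).2
    · obtain ⟨t, v, rfl, ht⟩ := exists_append_of_le_length (k := k - (u.length + 1)) (l := v)
        (by omega)
      obtain ⟨htt, hv⟩ := List.forall_mem_append.1 hv
      have e : ∀ a : ℝ, u ++ a :: (t ++ v) = (u ++ a :: t) ++ v := by simp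
      rw [e, e, listValue_append n (by simp; omega), listValue_append n (by simp; omega),
        binExp_middle, binExp_middle]
      simp only [zero_mul, one_mul, sub_zero, sub_self, zero_add, add_zero]
      have hut := List.forall_mem_append.2 ⟨hu, htt⟩
      have hunit := forall_mem_unit_of_Icc hp hq hut
      have hlen : (u ++ t).length + 1 = k := by simp; omega
      have hgu := (hg (u ++ t) hut hlen).2
      have hv' := forall_mem_map_tauReal hp hpq hq hv
      have key : ∀ j ≤ (u ++ t).length,
          listValue k m p q β n (nextList k p q (j + 1) v) -
            listValue k m p q β n (nextList k p q j v) ∈ Set.Icc 0 ((q - p) * D) := by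
        intro j hj
        have hl := forall_mem_replicate_Icc hpp (k - (j + 1))
        have hj' := forall_mem_replicate_Icc hqq j
        have hlen' : k ≤ (List.replicate j q).length + (v.map (tauReal p q)).length +
            (List.replicate (k - (j + 1)) p).length + 1 := by simp; omega
        -- The lists after `j + 1` and `j` successes differ by a `q` before the unsensed block
        -- against a `p` behind it. For the lower bound, raise that `p` to `q` in place and move it
        -- forward; for the upper bound, lower the `q` to `p` in place and move it backward.
        have h1 := H.max_forward hj' hv' hl (z := q) (fun x hx => (hv' x hx).2) hlen'
        have h2 := H.min_backward hj' hv' hl (z := p) (fun x hx => (hv' x hx).1) hlen'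
        have h3 := hstep hj' (List.forall_mem_append.2 ⟨hv', hl⟩) (by simp; omega)
        have h4 := hstep (List.forall_mem_append.2 ⟨hj', hv'⟩) hl (by simp; omega)
        have e1 : nextList k p q (j + 1) v = List.replicate j q ++ q ::
            (v.map (tauReal p q) ++ List.replicate (k - (j + 1)) p) := by
          simp [nextList, List.replicate_succ']
        have e2 : nextList k p q j v = List.replicate j q ++
            (v.map (tauReal p q) ++ p :: List.replicate (k - (j + 1)) p) := by
          rw [← replicate_sub_succ (by omega)]
          simp [nextList]
        simp only [List.append_assoc] at h4
        rw [e1, e2]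
        constructor
        · linarith [h4.1]
        · linarith [h3.2]
      rw [← binExp_sub]
      have hnonneg : ∀ j : ℕ, (0 : ℝ) ≤ ((min m (j + 1) : ℕ) : ℝ) - ((min m j : ℕ) : ℝ) := by
        intro j
        rw [sub_nonneg]
        exact_mod_cast min_le_min_left m (Nat.le_succ j)
      constructor
      · rw [← binExp_const (u ++ t) 0]
        refine binExp_mono hunit fun j hj => ?_
        have := mul_nonneg hβ (key j hj).1
        linarith [hnonneg j]
      · calc _ ≤ binExp (u ++ t) (fun j => ((min m (j + 1) : ℕ) : ℝ) - ((min m j : ℕ) : ℝ) +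
              (q - p) * D) := by
              refine binExp_mono hunit fun j hj => ?_
              have := mul_le_mul_of_nonneg_left (key j hj).2 hβ
              linarith
          _ ≤ D := by rw [binExp_add, binExp_const]; linarith

/-- Values of lists of equal length differ by a bounded amount, uniformly in the horizon. -/
theorem abs_sub_replicate_le (h : MyopicData k m p q β r R D) (n : ℕ) {u l : List ℝ}
    (hu : ∀ x ∈ u, x ∈ Set.Icc p q) (hl : ∀ x ∈ l, x ∈ Set.Icc p q)
    (hk : k ≤ u.length + l.length) :
    |listValue k m p q β n (u ++ l) - listValue k m p q β n (u ++ List.replicate l.length p)| ≤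
      l.length * D := by
  induction l generalizing u with
  | nil => simp
  | cons a l ih =>
    obtain ⟨ha, hl⟩ := List.forall_mem_cons.1 hl
    have hpp : p ∈ Set.Icc p q := ⟨le_rfl, h.hpq⟩
    simp only [List.length_cons] at hk
    have h1 := ih (u := u ++ [a]) (List.forall_mem_append.2 ⟨hu, List.forall_mem_singleton.2 ha⟩)
      hl (by simp; omega)
    simp only [List.append_assoc, List.cons_append, List.nil_append] at h1
    have h2 := h.slope_mem n (v := List.replicate l.length p) hu
      (forall_mem_replicate_Icc hpp _) (by simp; omega)
    have h3 : |listValue k m p q β n (u ++ a :: List.replicate l.length p) -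
        listValue k m p q β n (u ++ p :: List.replicate l.length p)| ≤ D := by
      rw [listValue_affine n u _ a, listValue_affine n u _ p]
      have e : a * listValue k m p q β n (u ++ 1 :: List.replicate l.length p) +
          (1 - a) * listValue k m p q β n (u ++ 0 :: List.replicate l.length p) -
          (p * listValue k m p q β n (u ++ 1 :: List.replicate l.length p) +
          (1 - p) * listValue k m p q β n (u ++ 0 :: List.replicate l.length p)) = (a - p) *
          (listValue k m p q β n (u ++ 1 :: List.replicate l.length p) -
            listValue k m p q β n (u ++ 0 :: List.replicate l.length p)) := by ring
      have ha1 : 0 ≤ a - p := sub_nonneg.2 ha.1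
      have ha2 : a - p ≤ 1 := by linarith [ha.2, h.hq, h.hp]
      rw [e, abs_of_nonneg (mul_nonneg ha1 h2.1)]
      nlinarith [h2.1, h2.2]
    rw [List.length_cons, List.replicate_succ]
    push_cast
    calc _ ≤ _ := abs_sub_le _ (listValue k m p q β n (u ++ a :: List.replicate l.length p)) _
      _ ≤ _ := by linarith

/-- Sorting a list of beliefs in decreasing order does not decrease its value. -/
theorem le_insertionSort (h : MyopicData k m p q β r R D) (n : ℕ) {u l : List ℝ}
    (hu : ∀ x ∈ u, x ∈ Set.Icc p q) (hl : ∀ x ∈ l, x ∈ Set.Icc p q)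
    (hk : k ≤ u.length + l.length) :
    listValue k m p q β n (u ++ l) ≤ listValue k m p q β n (u ++ l.insertionSort (· ≥ ·)) := by
  have H := h.exchangeBounds n
  induction l generalizing u with
  | nil => simp
  | cons a l ih =>
    obtain ⟨ha, hl⟩ := List.forall_mem_cons.1 hl
    simp only [List.length_cons] at hk
    have h1 := ih (u := u ++ [a]) (List.forall_mem_append.2 ⟨hu, List.forall_mem_singleton.2 ha⟩)
      hl (by simp; omega)
    simp only [List.append_assoc, List.cons_append, List.nil_append] at h1
    refine h1.trans ?_
    have hs : ∀ x ∈ l.insertionSort (· ≥ ·), x ∈ Set.Icc p q := fun x hx =>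
      hl x ((List.perm_insertionSort _ l).mem_iff.1 hx)
    have hlen : (l.insertionSort (· ≥ ·)).length = l.length := List.length_insertionSort _ l
    rw [List.insertionSort_cons]
    generalize l.insertionSort (· ≥ ·) = s at hs hlen
    rw [← hlen] at hk
    clear h1 ih hlen hl
    induction s generalizing u with
    | nil => simp
    | cons b s ih =>
      obtain ⟨hb, hs⟩ := List.forall_mem_cons.1 hs
      by_cases hab : a ≥ b
      · rw [List.orderedInsert_cons_of_le _ _ hab]
      · rw [List.orderedInsert_of_not_le _ _ hab]
        simp only [List.length_cons] at hk
        have h2 := ih (u := u ++ [b])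
          (List.forall_mem_append.2 ⟨hu, List.forall_mem_singleton.2 hb⟩) (by simp; omega) hs
        simp only [List.append_assoc, List.cons_append, List.nil_append] at h2
        exact (H.swap_adjacent hu hs (by omega) (not_le.1 hab).le).trans h2

end MyopicData

/-- Unlike the exchange bounds, this holds for beliefs anywhere in `[0, 1]`. It gives the global
boundedness that the strong law needs when the initial belief is arbitrary. -/
theorem listValue_mem (hp : 0 ≤ p) (hpq : p ≤ q) (hq : q ≤ 1) (hβ : 0 ≤ β) (hβ1 : β ≤ 1)
    (n : ℕ) {l : List ℝ} (hl : ∀ x ∈ l, x ∈ Set.Icc (0 : ℝ) 1) :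
    listValue k m p q β n l ∈ Set.Icc (0 : ℝ) (n * m) := by
  induction n generalizing l with
  | zero => simp [listValue]
  | succ n ih =>
    have ht : ∀ x ∈ l.take k, x ∈ Set.Icc (0 : ℝ) 1 := fun x hx => hl x (List.mem_of_mem_take hx)
    have key : ∀ j, ((min m j : ℕ) : ℝ) +
        β * listValue k m p q β n (nextList k p q j (l.drop k)) ∈
          Set.Icc (0 : ℝ) ((n + 1 : ℕ) * m) := by
      intro j
      have h1 := ih (l := nextList k p q j (l.drop k)) (by
        unfold nextList
        refine List.forall_mem_append.2 ⟨forall_mem_replicate_Icc ⟨hp.trans hpq, hq⟩ j,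
          List.forall_mem_append.2 ⟨?_, forall_mem_replicate_Icc ⟨hp, hpq.trans hq⟩ _⟩⟩
        intro y hy
        obtain ⟨x, hx, rfl⟩ := List.mem_map.1 hy
        have := tauReal_mem hpq (hl x (List.mem_of_mem_drop hx))
        exact ⟨hp.trans this.1, this.2.trans hq⟩)
      have h2 : ((min m j : ℕ) : ℝ) ≤ m := by exact_mod_cast min_le_left m j
      have h3 : (0 : ℝ) ≤ ((min m j : ℕ) : ℝ) := Nat.cast_nonneg _
      have h4 := mul_nonneg hβ h1.1
      have h5 := mul_le_mul hβ1 h1.2 h1.1 zero_le_one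
      push_cast
      push_cast at h2 h3
      constructor <;> nlinarith
    simp only [listValue]
    constructor
    · rw [← binExp_const (l.take k) 0]
      exact binExp_mono ht fun j _ => (key j).1
    · conv_rhs => rw [← binExp_const (l.take k) (((n + 1 : ℕ) : ℝ) * m)]
      exact binExp_mono ht fun j _ => (key j).2

end ListValueInduction

/-! ### The law of the channels -/

/-- Two finite measures on Boolean sequences agree if they give the same mass to all cylinders. -/
theorem ext_of_cylinder {μ ν : Measure (ℕ → Bool)} [IsFiniteMeasure μ] [IsFiniteMeasure ν]
    (h : ∀ (n : ℕ) (b : ℕ → Bool), μ.real {x | ∀ i ≤ n, x i = b i} =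
      ν.real {x | ∀ i ≤ n, x i = b i}) : μ = ν := by
  have hfam : IsProjectiveMeasureFamily (α := fun _ : ℕ => Bool)
      (fun S : Finset ℕ => μ.map S.restrict) := by
    intro S T hTS
    rw [Measure.map_map (by fun_prop) (by fun_prop), Finset.restrict₂_comp_restrict]
  have h1 : IsProjectiveLimit μ (fun S : Finset ℕ => μ.map S.restrict) := fun S => rfl
  have h2 : IsProjectiveLimit ν (fun S : Finset ℕ => μ.map S.restrict) := by
    rw [isProjectiveLimit_nat_iff hfam]
    intro n
    refine Measure.ext_of_singleton fun c => ?_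
    obtain ⟨b, rfl⟩ : ∃ b : ℕ → Bool, Preorder.frestrictLe n b = c :=
      ⟨fun i => if hi : i ∈ Finset.Iic n then c ⟨i, hi⟩ else true, by
        funext i; exact dif_pos i.2⟩
    have hset : Preorder.frestrictLe (π := fun _ => Bool) n ⁻¹' {Preorder.frestrictLe n b} =
        {x | ∀ i ≤ n, x i = b i} := by
      ext x
      simp only [Set.mem_preimage, Set.mem_singleton_iff, Set.mem_ofPred_eq, funext_iff,
        Subtype.forall, Finset.mem_Iic]
      rfl
    have h3 := h n b
    rw [← hset, measureReal_eq_measureReal_iff] at h3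
    rw [Measure.map_apply (by fun_prop) (measurableSet_singleton _), ← h3]
    exact (Measure.map_apply (μ := μ) (Preorder.measurable_frestrictLe (X := fun _ => Bool) n)
      (measurableSet_singleton _)).symm
  exact h1.unique h2

/-- Mass given to a state by the Bernoulli law with parameter `w`. -/
def stateProb (w : ℝ) (b : Bool) : ℝ := if b then w else 1 - w

theorem bernoulliMeasure_real_singleton (w : I) (b : Bool) :
    (bernoulliMeasure true false w).real {b} = stateProb w b := by
  cases b <;> simp [stateProb]

instance (p01 p11 w : I) : IsProbabilityMeasure (chainLaw p01 p11 w) := by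
  unfold chainLaw; infer_instance

instance {N : ℕ} (p01 p11 : I) (ω : Fin N → I) :
    IsProbabilityMeasure (channelLaw p01 p11 ω) := by
  unfold channelLaw; infer_instance

theorem map_eval_zero_chainLaw (p01 p11 w : I) :
    (chainLaw p01 p11 w).map (fun x => x 0) = bernoulliMeasure true false w := by
  have h : (chainLaw p01 p11 w).map (Preorder.frestrictLe (π := fun _ => Bool) 0) =
      (bernoulliMeasure true false w).map
        (MeasurableEquiv.piUnique (fun _ : Finset.Iic 0 => Bool)).symm := by
    rw [chainLaw, Kernel.trajMeasure, Measure.map_comp _ _ (by fun_prop),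
      Kernel.traj_map_frestrictLe, Kernel.partialTraj_self, Measure.id_comp]
  have h2 := congrArg (fun μ => μ.map (fun y : (i : Finset.Iic 0) → Bool =>
    y ⟨0, Finset.mem_Iic.2 le_rfl⟩)) h
  rw [Measure.map_map (by fun_prop) (by fun_prop), Measure.map_map (by fun_prop) (by fun_prop)]
    at h2
  simpa [Function.comp_def, MeasurableEquiv.piUnique] using h2

theorem measurableSet_cylinder (n : ℕ) (b : ℕ → Bool) :
    MeasurableSet {x : ℕ → Bool | ∀ i ≤ n, x i = b i} := by
  simp only [Set.ofPred_forall]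
  exact MeasurableSet.iInter fun i => MeasurableSet.iInter fun _ =>
    measurableSet_eq_fun (measurable_pi_apply i) measurable_const

/-- Cylinder masses determine the law, so this product formula reduces the shift and mixture
identities below to algebra in `stateProb`. -/
theorem chainLaw_cylinder (p01 p11 w : I) (n : ℕ) (b : ℕ → Bool) :
    (chainLaw p01 p11 w).real {x | ∀ i ≤ n, x i = b i} =
      stateProb w (b 0) *
        ∏ i ∈ Finset.range n, stateProb (if b i then p11 else p01 : I) (b (i + 1)) := by
  induction n with
  | zero =>
    rw [← bernoulliMeasure_real_singleton, ← map_eval_zero_chainLaw p01 p11 w,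
      map_measureReal_apply (by fun_prop) (measurableSet_singleton _)]
    simp [Set.preimage]
  | succ n ih =>
    rw [Finset.prod_range_succ, ← mul_assoc, ← ih]
    have h := Kernel.map_frestrictLe_trajMeasure_compProd_eq_map_trajMeasure
      (X := fun _ => Bool) (μ₀ := bernoulliMeasure true false w)
      (κ := fun n => (transition p01 p11).comap
        (fun h : (i : Finset.Iic n) → Bool => h ⟨n, Finset.mem_Iic.2 le_rfl⟩)
        (measurable_pi_apply _)) (a := n)
    have h2 := congrArg (fun μ => μ.real
      ({Preorder.frestrictLe (π := fun _ => Bool) n b} ×ˢ {b (n + 1)})) h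
    change (((chainLaw p01 p11 w).map _) ⊗ₘ _).real _ = ((chainLaw p01 p11 w).map _).real _ at h2
    have hset : Preorder.frestrictLe (π := fun _ => Bool) n ⁻¹' {Preorder.frestrictLe n b} =
        {x | ∀ i ≤ n, x i = b i} := by
      ext x
      simp only [Set.mem_preimage, Set.mem_singleton_iff, Set.mem_ofPred_eq, funext_iff,
        Subtype.forall, Finset.mem_Iic]
      rfl
    have hset2 : (fun x : ℕ → Bool => (Preorder.frestrictLe (π := fun _ => Bool) n x, x (n + 1))) ⁻¹'
        ({Preorder.frestrictLe (π := fun _ => Bool) n b} ×ˢ {b (n + 1)}) =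
        {x | ∀ i ≤ n + 1, x i = b i} := by
      ext x
      have : x ∈ Preorder.frestrictLe (π := fun _ => Bool) n ⁻¹' {Preorder.frestrictLe n b} ↔
        ∀ i ≤ n, x i = b i := by rw [hset]; rfl
      simp only [Set.mem_preimage, Set.mem_prod] at this ⊢
      rw [this]
      simp only [Set.mem_singleton_iff, Set.mem_ofPred_eq]
      constructor
      · rintro ⟨h1, h2⟩ i hi
        rcases Nat.lt_or_ge n i with hn | hn
        · obtain rfl : i = n + 1 := by omega
          exact h2
        · exact h1 i hn
      · exact fun h => ⟨fun i hi => h i (by omega), h _ le_rfl⟩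
    rw [map_measureReal_apply (by fun_prop) ((measurableSet_singleton _).prod
      (measurableSet_singleton _)), hset2] at h2
    rw [← h2, measureReal_def, Measure.compProd_apply_prod (measurableSet_singleton _)
      (measurableSet_singleton _), Measure.restrict_singleton, lintegral_smul_measure,
      lintegral_dirac, smul_eq_mul, ENNReal.toReal_mul, ← measureReal_def, ← measureReal_def,
      map_measureReal_apply (by fun_prop) (measurableSet_singleton _), hset]
    congr 1
    rw [Kernel.comap_apply]
    exact bernoulliMeasure_real_singleton _ _

/-- The time shift of trajectories. -/
def shift (x : ℕ → Bool) : ℕ → Bool := fun t => x (t + 1)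

theorem measurable_shift : Measurable shift :=
  measurable_pi_lambda _ fun t => measurable_pi_apply (t + 1)

theorem map_shift_chainLaw (p01 p11 w : I) :
    (chainLaw p01 p11 w).map shift = chainLaw p01 p11 (tau p01 p11 w) := by
  have : IsProbabilityMeasure ((chainLaw p01 p11 w).map shift) :=
    Measure.isProbabilityMeasure_map measurable_shift.aemeasurable
  refine ext_of_cylinder fun n b => ?_
  rw [map_measureReal_apply measurable_shift (measurableSet_cylinder n b)]
  let c : Bool → ℕ → Bool := fun a i => Nat.casesOn i a b
  have hset : shift ⁻¹' {x | ∀ i ≤ n, x i = b i} =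
      {x | ∀ i ≤ n + 1, x i = c true i} ∪ {x | ∀ i ≤ n + 1, x i = c false i} := by
    ext x
    have key : ∀ a, (∀ i ≤ n + 1, x i = c a i) ↔ x 0 = a ∧ ∀ i ≤ n, shift x i = b i := by
      intro a
      constructor
      · exact fun h => ⟨h 0 (by omega), fun i hi => h (i + 1) (by omega)⟩
      · rintro ⟨h1, h2⟩ i hi
        cases i with
        | zero => exact h1
        | succ i => exact h2 i (by omega)
    simp only [Set.mem_preimage, Set.mem_union, Set.mem_ofPred_eq, key]
    cases x 0 <;> simp
  rw [hset, measureReal_union _ (measurableSet_cylinder _ _)]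
  · simp only [chainLaw_cylinder, Finset.prod_range_succ', c]
    have e : stateProb (tau p01 p11 w) (b 0) =
        stateProb w true * stateProb p11 (b 0) + stateProb w false * stateProb p01 (b 0) := by
      cases b 0 <;> simp [stateProb, tau]
      ring
    rw [e]
    simp
    ring
  · rw [Set.disjoint_left]
    intro x h1 h2
    exact Bool.noConfusion ((h1 0 (by omega)).symm.trans (h2 0 (by omega)))

theorem chainLaw_affine (p01 p11 w : I) :
    chainLaw p01 p11 w = ENNReal.ofReal w • chainLaw p01 p11 1 +
      ENNReal.ofReal (1 - w) • chainLaw p01 p11 0 := by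
  have : IsFiniteMeasure (ENNReal.ofReal w • chainLaw p01 p11 1) :=
    Measure.smul_finite _ ENNReal.ofReal_ne_top
  have : IsFiniteMeasure (ENNReal.ofReal (1 - w) • chainLaw p01 p11 0) :=
    Measure.smul_finite _ ENNReal.ofReal_ne_top
  refine ext_of_cylinder fun n b => ?_
  rw [measureReal_add_apply, measureReal_ennreal_smul_apply, measureReal_ennreal_smul_apply,
    ENNReal.toReal_ofReal w.2.1, ENNReal.toReal_ofReal (sub_nonneg.2 w.2.2)]
  simp only [chainLaw_cylinder]
  have e : stateProb w (b 0) = w * stateProb (1 : I) (b 0) + (1 - w) * stateProb (0 : I) (b 0) := by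
    cases b 0 <;> simp [stateProb]
  rw [e]
  ring

theorem chainLaw_one_ae (p01 p11 : I) : ∀ᵐ x ∂(chainLaw p01 p11 1), x 0 = true := by
  have h := chainLaw_cylinder p01 p11 1 0 (fun _ => false)
  rw [ae_iff]
  simpa [stateProb, measureReal_eq_zero_iff] using h

theorem chainLaw_zero_ae (p01 p11 : I) : ∀ᵐ x ∂(chainLaw p01 p11 0), x 0 = false := by
  have h := chainLaw_cylinder p01 p11 0 0 (fun _ => true)
  rw [ae_iff]
  simpa [stateProb, measureReal_eq_zero_iff] using h

variable {N k : ℕ}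

/-- Only the factor `i` of a rectangle's mass depends on `ω i`, and that factor is a mixture by
`chainLaw_affine`. -/
theorem channelLaw_affine (p01 p11 : I) (ω : Fin N → I) (i : Fin N) :
    channelLaw p01 p11 ω = ENNReal.ofReal (ω i) • channelLaw p01 p11 (Function.update ω i 1) +
      ENNReal.ofReal (1 - ω i) • channelLaw p01 p11 (Function.update ω i 0) := by
  refine Measure.pi_eq fun s _ => ?_
  have key : ∀ c : I, channelLaw p01 p11 (Function.update ω i c) (Set.univ.pi s) =
      chainLaw p01 p11 c (s i) * ∏ j ∈ Finset.univ.erase i, chainLaw p01 p11 (ω j) (s j) := by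
    intro c
    rw [channelLaw, Measure.pi_pi, ← Finset.mul_prod_erase _ _ (Finset.mem_univ i),
      Function.update_self]
    congr 1
    refine Finset.prod_congr rfl fun j hj => ?_
    rw [Function.update_of_ne (Finset.ne_of_mem_erase hj)]
  rw [Measure.add_apply, Measure.smul_apply, Measure.smul_apply, key, key,
    ← Finset.mul_prod_erase _ _ (Finset.mem_univ i), chainLaw_affine p01 p11 (ω i),
    Measure.add_apply, Measure.smul_apply, Measure.smul_apply]
  simp only [smul_eq_mul]
  ring

theorem map_shift_channelLaw (p01 p11 : I) (ω : Fin N → I) :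
    (channelLaw p01 p11 ω).map (fun x i => shift (x i)) =
      channelLaw p01 p11 (fun i => tau p01 p11 (ω i)) := by
  have : ∀ i, IsProbabilityMeasure ((chainLaw p01 p11 (ω i)).map shift) := fun i =>
    Measure.isProbabilityMeasure_map measurable_shift.aemeasurable
  rw [channelLaw, Measure.pi_map_pi fun i => measurable_shift.aemeasurable]
  simp only [map_shift_chainLaw, channelLaw]

theorem channelLaw_ae (p01 p11 : I) (ω : Fin N → I) (i : Fin N) {P : (ℕ → Bool) → Prop}
    (h : ∀ᵐ x ∂(chainLaw p01 p11 (ω i)), P x) : ∀ᵐ x ∂(channelLaw p01 p11 ω), P (x i) :=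
  (Measure.quasiMeasurePreserving_eval _ i).ae h

/-! ### The first-step decomposition -/

/-- Probability that exactly the channels in `g` among those in `s` are in state `1`. -/
def outcomeProb (ω : Fin N → I) (s g : Finset (Fin N)) : ℝ :=
  (∏ i ∈ g, (ω i : ℝ)) * ∏ i ∈ s \ g, (1 - (ω i : ℝ))

/-- Beliefs after the channels in `s` were sensed, those in `g` being in state `1`. -/
def posterior (ω : Fin N → I) (s g : Finset (Fin N)) : Fin N → I :=
  fun i => if i ∈ s then (if i ∈ g then 1 else 0) else ω i

/-- Beliefs at the next step after the channels in `s` were sensed, those in `g` being in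
state `1`. -/
def nextBelief (p01 p11 : I) (ω : Fin N → I) (s g : Finset (Fin N)) : Fin N → I :=
  fun i => tau p01 p11 (posterior ω s g i)

theorem sum_outcomeProb_insert (ω : Fin N → I) {s : Finset (Fin N)} {a : Fin N} (ha : a ∉ s)
    (F : Finset (Fin N) → ℝ) :
    ∑ g ∈ (insert a s).powerset, outcomeProb ω (insert a s) g * F g =
      ω a * ∑ g ∈ s.powerset, outcomeProb ω s g * F (insert a g) +
        (1 - ω a) * ∑ g ∈ s.powerset, outcomeProb ω s g * F g := by
  rw [Finset.sum_powerset_insert ha, add_comm, Finset.mul_sum, Finset.mul_sum]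
  congr 1 <;> refine Finset.sum_congr rfl fun g hg => ?_
  · have hag : a ∉ g := fun h => ha (Finset.mem_powerset.1 hg h)
    have e : insert a s \ insert a g = s \ g := by
      ext i; simp only [Finset.mem_sdiff, Finset.mem_insert]; grind
    rw [outcomeProb, outcomeProb, Finset.prod_insert hag, e]
    ring
  · have hag : a ∉ g := fun h => ha (Finset.mem_powerset.1 hg h)
    have e : insert a s \ g = insert a (s \ g) := Finset.insert_sdiff_of_notMem _ hag
    rw [outcomeProb, outcomeProb, e, Finset.prod_insert (by simp [ha])]
    ring

theorem outcomeProb_nonneg (ω : Fin N → I) (s g : Finset (Fin N)) : 0 ≤ outcomeProb ω s g :=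
  mul_nonneg (Finset.prod_nonneg fun i _ => (ω i).2.1)
    (Finset.prod_nonneg fun i _ => sub_nonneg.2 (ω i).2.2)

theorem sum_outcomeProb (ω : Fin N → I) (s : Finset (Fin N)) :
    ∑ g ∈ s.powerset, outcomeProb ω s g = 1 := by
  induction s using Finset.induction_on with
  | empty => simp [outcomeProb]
  | insert a s ha ih =>
    have h := sum_outcomeProb_insert ω ha fun _ => 1
    simp only [mul_one, ih] at h
    rw [h]
    ring

/-- Conditioning on the sensed states is expressed as a finite mixture: each channel of `s` is split
into its surely good and surely bad versions. No conditional expectations are needed. -/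
theorem integral_channelLaw_posterior (p01 p11 : I) (ω : Fin N → I) (s : Finset (Fin N))
    {Φ : (Fin N → ℕ → Bool) → ℝ} (hΦ : ∀ ω, Integrable Φ (channelLaw p01 p11 ω)) :
    ∫ x, Φ x ∂(channelLaw p01 p11 ω) =
      ∑ g ∈ s.powerset, outcomeProb ω s g * ∫ x, Φ x ∂(channelLaw p01 p11 (posterior ω s g)) := by
  induction s using Finset.induction_on with
  | empty =>
    have : posterior ω ∅ ∅ = ω := by funext i; simp [posterior]
    simp [outcomeProb, this]
  | insert a s ha ih =>
    rw [ih, sum_outcomeProb_insert ω ha, Finset.mul_sum, Finset.mul_sum, ← Finset.sum_add_distrib]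
    refine Finset.sum_congr rfl fun g hg => ?_
    have hag : a ∉ g := fun h => ha (Finset.mem_powerset.1 hg h)
    have e1 : posterior ω (insert a s) (insert a g) = Function.update (posterior ω s g) a 1 := by
      funext i
      by_cases hi : i = a
      · subst hi; simp [posterior]
      · simp [posterior, hi]
    have e0 : posterior ω (insert a s) g = Function.update (posterior ω s g) a 0 := by
      funext i
      by_cases hi : i = a
      · subst hi; simp [posterior, hag]
      · simp [posterior, hi]
    have ea : posterior ω s g a = ω a := by simp [posterior, ha]
    have hint := channelLaw_affine p01 p11 (posterior ω s g) a
    rw [e1, e0, hint, integral_add_measure ((hΦ _).smul_measure ENNReal.ofReal_ne_top)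
      ((hΦ _).smul_measure ENNReal.ofReal_ne_top), integral_smul_measure, integral_smul_measure,
      ea, ENNReal.toReal_ofReal (ω a).2.1, ENNReal.toReal_ofReal (sub_nonneg.2 (ω a).2.2)]
    simp only [smul_eq_mul]
    ring

/-- Expectation of a function of the states of the channels in `s` at the first step and of the
later states of all channels. -/
theorem integral_channelLaw_firstStep (p01 p11 : I) (ω : Fin N → I) (s : Finset (Fin N))
    {Φ : (Fin N → ℕ → Bool) → ℝ} (hΦ : ∀ ω, Integrable Φ (channelLaw p01 p11 ω))
    (Ψ : Finset (Fin N) → (Fin N → ℕ → Bool) → ℝ) (hΨ : ∀ g, Measurable (Ψ g))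
    (h : ∀ x, Φ x = Ψ (s.filter fun i => x i 0 = true) (fun i => shift (x i))) :
    ∫ x, Φ x ∂(channelLaw p01 p11 ω) =
      ∑ g ∈ s.powerset, outcomeProb ω s g *
        ∫ x, Ψ g x ∂(channelLaw p01 p11 (nextBelief p01 p11 ω s g)) := by
  rw [integral_channelLaw_posterior p01 p11 ω s hΦ]
  refine Finset.sum_congr rfl fun g hg => ?_
  congr 1
  have hsh : Measurable fun (x : Fin N → ℕ → Bool) i => shift (x i) :=
    measurable_pi_lambda _ fun i => measurable_shift.comp (measurable_pi_apply i)
  have hmap := map_shift_channelLaw p01 p11 (posterior ω s g)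
  change _ = channelLaw p01 p11 (nextBelief p01 p11 ω s g) at hmap
  rw [← hmap, integral_map hsh.aemeasurable (hΨ g).aestronglyMeasurable]
  refine integral_congr_ae ?_
  -- Under the posterior law the sensed channels have deterministic initial states, so the observed
  -- set is almost surely `g`.
  have hae : ∀ᵐ x ∂(channelLaw p01 p11 (posterior ω s g)), ∀ i, i ∈ s →
      (x i 0 = true ↔ i ∈ g) := by
    rw [ae_all_iff]
    intro i
    by_cases his : i ∈ s
    · by_cases hig : i ∈ g
      · have : posterior ω s g i = 1 := by simp [posterior, his, hig]
        have h1 := channelLaw_ae p01 p11 (posterior ω s g) i (P := fun x => x 0 = true)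
          (by rw [this]; exact chainLaw_one_ae p01 p11)
        filter_upwards [h1] with x hx _
        simp [hx, hig]
      · have : posterior ω s g i = 0 := by simp [posterior, his, hig]
        have h1 := channelLaw_ae p01 p11 (posterior ω s g) i (P := fun x => x 0 = false)
          (by rw [this]; exact chainLaw_zero_ae p01 p11)
        filter_upwards [h1] with x hx _
        simp [hx, hig]
    · exact Eventually.of_forall fun x h => absurd h his
  filter_upwards [hae] with x hx
  have : (s.filter fun i => x i 0 = true) = g := by
    ext i
    rw [Finset.mem_filter]
    exact ⟨fun hi => (hx i hi.1).1 hi.2, fun hi =>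
      ⟨Finset.mem_powerset.1 hg hi, (hx i (Finset.mem_powerset.1 hg hi)).2 hi⟩⟩
  rw [h, this]

/-- A function of finitely many coordinates of the trajectories is measurable. -/
theorem measurable_of_finite_horizon {F : (Fin N → ℕ → Bool) → ℝ} (T : ℕ)
    (h : ∀ x y, (∀ i, ∀ t < T, x i t = y i t) → F x = F y) : Measurable F := by
  let r : (Fin N → ℕ → Bool) → (Fin N → Fin T → Bool) := fun x i t => x i t
  let e : (Fin N → Fin T → Bool) → (Fin N → ℕ → Bool) :=
    fun y i t => if ht : t < T then y i ⟨t, ht⟩ else true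
  have hF : F = (F ∘ e) ∘ r := by
    funext x
    exact h _ _ fun i t ht => by simp [e, r, ht]
  have hr : Measurable r := measurable_pi_lambda _ fun i => measurable_pi_lambda _ fun t =>
    (measurable_pi_apply (t : ℕ)).comp (measurable_pi_apply i)
  rw [hF]
  exact (measurable_of_finite (F ∘ e)).comp hr

/-! ### Dynamics of the beliefs -/

theorem tau_one (p01 p11 : I) : tau p01 p11 1 = p11 := by
  ext; simp [tau]

theorem tau_zero (p01 p11 : I) : tau p01 p11 0 = p01 := by
  ext; simp [tau]

/-- The channels sensed at time `t` and found in state `1`. -/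
def observedGood (p01 p11 : I) (π : Policy N k) (ω : Fin N → I) (x : Fin N → ℕ → Bool) (t : ℕ) :
    Finset (Fin N) :=
  (π t (belief p01 p11 π ω x t)).1.filter fun i => x i t = true

theorem belief_succ (p01 p11 : I) (π : Policy N k) (ω : Fin N → I) (x : Fin N → ℕ → Bool)
    (t : ℕ) : belief p01 p11 π ω x (t + 1) =
      nextBelief p01 p11 (belief p01 p11 π ω x t) (π t (belief p01 p11 π ω x t)).1
        (observedGood p01 p11 π ω x t) := by
  funext i
  simp only [belief, nextBelief, posterior, observedGood, Finset.mem_filter]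
  split_ifs <;> simp_all [tau_one, tau_zero]

/-- The policy that remains after the first step. -/
def Policy.tail (π : Policy N k) : Policy N k := fun t => π (t + 1)

/-- Beliefs are a sufficient statistic: after one step the process restarts from the updated belief
on shifted trajectories. This is what makes induction on the horizon possible for an arbitrary
policy. -/
theorem belief_tail (p01 p11 : I) (π : Policy N k) (ω : Fin N → I) (x : Fin N → ℕ → Bool)
    (t : ℕ) : belief p01 p11 π ω x (t + 1) =
      belief p01 p11 (Policy.tail π)
        (nextBelief p01 p11 ω (π 0 ω).1 ((π 0 ω).1.filter fun i => x i 0 = true))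
        (fun i => shift (x i)) t := by
  induction t with
  | zero => exact belief_succ p01 p11 π ω x 0
  | succ t ih =>
    rw [belief_succ, belief_succ p01 p11 (Policy.tail π), observedGood, observedGood, ih]
    rfl

/-- A quantity incurred at time `t` that depends on the current beliefs, on the sensed channels and
on those found in state `1`. -/
def stepCost (p01 p11 : I) (c : (Fin N → I) → Finset (Fin N) → Finset (Fin N) → ℝ)
    (π : Policy N k) (ω : Fin N → I) (x : Fin N → ℕ → Bool) (t : ℕ) : ℝ :=
  c (belief p01 p11 π ω x t) (π t (belief p01 p11 π ω x t)).1 (observedGood p01 p11 π ω x t)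

theorem stepCost_tail (p01 p11 : I) (c : (Fin N → I) → Finset (Fin N) → Finset (Fin N) → ℝ)
    (π : Policy N k) (ω : Fin N → I) (x : Fin N → ℕ → Bool) (t : ℕ) :
    stepCost p01 p11 c π ω x (t + 1) =
      stepCost p01 p11 c (Policy.tail π)
        (nextBelief p01 p11 ω (π 0 ω).1 ((π 0 ω).1.filter fun i => x i 0 = true))
        (fun i => shift (x i)) t := by
  rw [stepCost, stepCost, observedGood, observedGood, belief_tail]
  rfl

theorem belief_congr (p01 p11 : I) (π : Policy N k) (ω : Fin N → I) {x y : Fin N → ℕ → Bool}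
    {T : ℕ} (h : ∀ i, ∀ t < T, x i t = y i t) {t : ℕ} (ht : t ≤ T) :
    belief p01 p11 π ω x t = belief p01 p11 π ω y t := by
  induction t with
  | zero => rfl
  | succ t ih =>
    funext i
    simp only [belief]
    rw [ih (by omega), h i t (by omega)]

theorem stepCost_congr (p01 p11 : I) (c : (Fin N → I) → Finset (Fin N) → Finset (Fin N) → ℝ)
    (π : Policy N k) (ω : Fin N → I) {x y : Fin N → ℕ → Bool}
    {T : ℕ} (h : ∀ i, ∀ t < T, x i t = y i t) {t : ℕ} (ht : t < T) :
    stepCost p01 p11 c π ω x t = stepCost p01 p11 c π ω y t := by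
  have hx : ∀ i, x i t = y i t := fun i => h i t ht
  simp only [stepCost, observedGood, belief_congr p01 p11 π ω h ht.le, hx]

/-- Discounted sum of the first `T` step costs. -/
def sumCost (p01 p11 : I) (c : (Fin N → I) → Finset (Fin N) → Finset (Fin N) → ℝ) (β : ℝ)
    (π : Policy N k) (ω : Fin N → I) (T : ℕ) (x : Fin N → ℕ → Bool) : ℝ :=
  ∑ t ∈ Finset.range T, β ^ t * stepCost p01 p11 c π ω x t

/-! ### Mean and variance of cumulative step costs -/

section SumCost

variable (p01 p11 : I) (c : (Fin N → I) → Finset (Fin N) → Finset (Fin N) → ℝ) (β : ℝ)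

theorem measurable_sumCost (π : Policy N k) (ω : Fin N → I) (T : ℕ) :
    Measurable (sumCost p01 p11 c β π ω T) := by
  refine measurable_of_finite_horizon T fun x y h => Finset.sum_congr rfl fun t ht => ?_
  rw [stepCost_congr p01 p11 c π ω h (Finset.mem_range.1 ht)]

theorem sumCost_succ (π : Policy N k) (ω : Fin N → I) (T : ℕ) (x : Fin N → ℕ → Bool) :
    sumCost p01 p11 c β π ω (T + 1) x =
      c ω (π 0 ω).1 ((π 0 ω).1.filter fun i => x i 0 = true) +
        β * sumCost p01 p11 c β (Policy.tail π)
          (nextBelief p01 p11 ω (π 0 ω).1 ((π 0 ω).1.filter fun i => x i 0 = true)) T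
          (fun i => shift (x i)) := by
  simp only [sumCost]
  rw [Finset.sum_range_succ', add_comm, Finset.mul_sum]
  congr 1
  · simp [stepCost, observedGood, belief]
  · refine Finset.sum_congr rfl fun t _ => ?_
    rw [stepCost_tail]
    ring

variable {c}

theorem abs_sumCost_le {C : ℝ} (hc : ∀ ω s g, |c ω s g| ≤ C) (π : Policy N k) (ω : Fin N → I)
    (T : ℕ) (x : Fin N → ℕ → Bool) :
    |sumCost p01 p11 c β π ω T x| ≤ ∑ t ∈ Finset.range T, |β| ^ t * C := by
  refine (Finset.abs_sum_le_sum_abs _ _).trans (Finset.sum_le_sum fun t _ => ?_)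
  rw [abs_mul, abs_pow]
  exact mul_le_mul_of_nonneg_left (hc _ _ _) (by positivity)

theorem integrable_sumCost {C : ℝ} (hc : ∀ ω s g, |c ω s g| ≤ C) (π : Policy N k)
    (ω : Fin N → I) (T : ℕ) (μ : Measure (Fin N → ℕ → Bool)) [IsFiniteMeasure μ] :
    Integrable (sumCost p01 p11 c β π ω T) μ :=
  Integrable.of_bound (measurable_sumCost p01 p11 c β π ω T).aestronglyMeasurable _
    (Eventually.of_forall fun x => abs_sumCost_le p01 p11 β hc π ω T x)

theorem integral_sumCost_succ {C : ℝ} (hc : ∀ ω s g, |c ω s g| ≤ C) (π : Policy N k)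
    (ω : Fin N → I) (T : ℕ) :
    ∫ x, sumCost p01 p11 c β π ω (T + 1) x ∂(channelLaw p01 p11 ω) =
      ∑ g ∈ (π 0 ω).1.powerset, outcomeProb ω (π 0 ω).1 g * (c ω (π 0 ω).1 g +
        β * ∫ x, sumCost p01 p11 c β (Policy.tail π) (nextBelief p01 p11 ω (π 0 ω).1 g) T x
          ∂(channelLaw p01 p11 (nextBelief p01 p11 ω (π 0 ω).1 g))) := by
  rw [integral_channelLaw_firstStep p01 p11 ω (π 0 ω).1
    (fun ω' => integrable_sumCost p01 p11 β hc π ω (T + 1) _)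
    (fun g x => c ω (π 0 ω).1 g + β * sumCost p01 p11 c β (Policy.tail π)
      (nextBelief p01 p11 ω (π 0 ω).1 g) T x)
    (fun g => ((measurable_sumCost p01 p11 c β _ _ T).const_mul β).const_add _)
    (fun x => sumCost_succ p01 p11 c β π ω T x)]
  refine Finset.sum_congr rfl fun g _ => ?_
  congr 1
  rw [integral_add (integrable_const _)
    ((integrable_sumCost p01 p11 β hc _ _ T _).const_mul β), integral_const_mul]
  simp

theorem integral_sumCost_eq_zero {C : ℝ} (hc : ∀ ω s g, |c ω s g| ≤ C)
    (h0 : ∀ ω s, ∑ g ∈ s.powerset, outcomeProb ω s g * c ω s g = 0) (π : Policy N k)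
    (ω : Fin N → I) (T : ℕ) :
    ∫ x, sumCost p01 p11 c β π ω T x ∂(channelLaw p01 p11 ω) = 0 := by
  induction T generalizing π ω with
  | zero => simp [sumCost]
  | succ T ih =>
    rw [integral_sumCost_succ p01 p11 β hc]
    simp only [ih, mul_zero, add_zero]
    exact h0 _ _

/-- Centred step costs are orthogonal, so the variance of their sum grows linearly. -/
theorem integral_sumCost_sq_le {C : ℝ} (hc : ∀ ω s g, |c ω s g| ≤ C)
    (h0 : ∀ ω s, ∑ g ∈ s.powerset, outcomeProb ω s g * c ω s g = 0) (π : Policy N k)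
    (ω : Fin N → I) (T : ℕ) :
    ∫ x, sumCost p01 p11 c 1 π ω T x ^ 2 ∂(channelLaw p01 p11 ω) ≤ T * C ^ 2 := by
  have hint : ∀ (π : Policy N k) (ω : Fin N → I) (T : ℕ) (μ : Measure (Fin N → ℕ → Bool))
      [IsFiniteMeasure μ], Integrable (fun x => sumCost p01 p11 c 1 π ω T x ^ 2) μ := by
    intro π ω T μ _
    refine Integrable.of_bound
      ((measurable_sumCost p01 p11 c 1 π ω T).pow_const 2).aestronglyMeasurable
      ((∑ t ∈ Finset.range T, |(1 : ℝ)| ^ t * C) ^ 2) (Eventually.of_forall fun x => ?_)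
    rw [Real.norm_eq_abs, abs_pow]
    exact pow_le_pow_left₀ (abs_nonneg _) (abs_sumCost_le p01 p11 1 hc π ω T x) 2
  induction T generalizing π ω with
  | zero => simp [sumCost]
  | succ T ih =>
    rw [integral_channelLaw_firstStep p01 p11 ω (π 0 ω).1 (fun ω' => hint π ω (T + 1) _)
      (fun g x => (c ω (π 0 ω).1 g + 1 * sumCost p01 p11 c 1 (Policy.tail π)
        (nextBelief p01 p11 ω (π 0 ω).1 g) T x) ^ 2)
      (fun g => (((measurable_sumCost p01 p11 c 1 _ _ T).const_mul 1).const_add _).pow_const 2)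
      (fun x => by rw [sumCost_succ])]
    calc _ ≤ ∑ g ∈ (π 0 ω).1.powerset, outcomeProb ω (π 0 ω).1 g * (((T + 1 : ℕ) : ℝ) * C ^ 2) := by
          refine Finset.sum_le_sum fun g _ =>
            mul_le_mul_of_nonneg_left ?_ (outcomeProb_nonneg _ _ _)
          set ω' := nextBelief p01 p11 ω (π 0 ω).1 g
          have e : ∀ x, (c ω (π 0 ω).1 g + 1 * sumCost p01 p11 c 1 (Policy.tail π) ω' T x) ^ 2 =
              c ω (π 0 ω).1 g ^ 2 + (2 * c ω (π 0 ω).1 g *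
                sumCost p01 p11 c 1 (Policy.tail π) ω' T x +
                sumCost p01 p11 c 1 (Policy.tail π) ω' T x ^ 2) := fun x => by ring
          simp only [e]
          have i1 := (integrable_sumCost p01 p11 1 hc (Policy.tail π) ω' T
            (channelLaw p01 p11 ω')).const_mul (2 * c ω (π 0 ω).1 g)
          have i2 := hint (Policy.tail π) ω' T (channelLaw p01 p11 ω')
          have i3 : Integrable (fun x => 2 * c ω (π 0 ω).1 g *
              sumCost p01 p11 c 1 (Policy.tail π) ω' T x +
              sumCost p01 p11 c 1 (Policy.tail π) ω' T x ^ 2) (channelLaw p01 p11 ω') := i1.add i2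
          -- The cross term vanishes: given the first outcome, the remaining cost has mean zero.
          rw [integral_add (integrable_const _) i3, integral_add i1 i2,
            integral_const_mul, integral_sumCost_eq_zero p01 p11 1 hc h0]
          have h1 : c ω (π 0 ω).1 g ^ 2 ≤ C ^ 2 := sq_le_sq' (neg_le_of_abs_le (hc _ _ _))
            (le_of_abs_le (hc _ _ _))
          have h2 := ih (Policy.tail π) ω'
          simp only [integral_const, probReal_univ, one_smul, mul_zero, zero_add]
          push_cast
          linarith
      _ = _ := by rw [← Finset.sum_mul, sum_outcomeProb, one_mul]

end SumCost

/-! ### A strong law for centred step costs -/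

/-- By Tonelli the sum of the functions has finite integral, hence is almost surely finite, so its
terms tend to zero. -/
theorem ae_tendsto_zero_of_summable_integral {α : Type*} [MeasurableSpace α] {μ : Measure α}
    {f : ℕ → α → ℝ} (hf : ∀ n, Measurable (f n)) (hi : ∀ n, Integrable (f n) μ)
    (h0 : ∀ n x, 0 ≤ f n x) (hs : Summable fun n => ∫ x, f n x ∂μ) :
    ∀ᵐ x ∂μ, Tendsto (fun n => f n x) atTop (𝓝 0) := by
  have h1 : ∫⁻ x, ∑' n, ENNReal.ofReal (f n x) ∂μ ≠ ⊤ := by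
    rw [lintegral_tsum fun n => (hf n).ennreal_ofReal.aemeasurable]
    simp only [← ofReal_integral_eq_lintegral_ofReal (hi _) (Eventually.of_forall (h0 _))]
    exact hs.tsum_ofReal_ne_top
  have h2 := ae_lt_top (Measurable.tsum fun n => (hf n).ennreal_ofReal) h1
  filter_upwards [h2] with x hx
  have h3 := (ENNReal.tendsto_toReal ENNReal.zero_ne_top).comp
    (ENNReal.tendsto_atTop_zero_of_tsum_ne_top hx.ne)
  simpa [Function.comp_def, ENNReal.toReal_ofReal, h0] using h3

/-- A sequence with bounded increments is `o(n)` if it is so along the squares. -/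
theorem tendsto_div_of_tendsto_sq {S : ℕ → ℝ} {C : ℝ} (hC : ∀ n, |S (n + 1) - S n| ≤ C)
    (h : Tendsto (fun n : ℕ => S ((n + 1) ^ 2) / ((n + 1 : ℝ) ^ 2)) atTop (𝓝 0)) :
    Tendsto (fun n : ℕ => S n / n) atTop (𝓝 0) := by
  have hC0 : 0 ≤ C := (abs_nonneg _).trans (hC 0)
  have hinc : ∀ a b : ℕ, |S (a + b) - S a| ≤ b * C := by
    intro a b
    induction b with
    | zero => simp
    | succ b ih =>
      calc |S (a + (b + 1)) - S a| ≤ |S (a + b + 1) - S (a + b)| + |S (a + b) - S a| :=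
            abs_sub_le _ _ _
        _ ≤ _ := by push_cast; linarith [hC (a + b)]
  have h' : Tendsto (fun n : ℕ => |S (n ^ 2) / (n : ℝ) ^ 2|) atTop (𝓝 0) := by
    rw [← tendsto_add_atTop_iff_nat 1]
    simpa using h.abs
  have hsqrt : Tendsto Nat.sqrt atTop atTop :=
    tendsto_atTop_atTop.2 fun b => ⟨b ^ 2, fun a ha => Nat.le_sqrt'.2 ha⟩
  have h1 := (h'.add ((tendsto_inv_atTop_nhds_zero_nat (𝕜 := ℝ)).const_mul (2 * C))).comp hsqrt
  rw [mul_zero, add_zero] at h1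
  refine squeeze_zero_norm' ?_ h1
  filter_upwards [eventually_ge_atTop 1] with n hn
  have hs1 : Nat.sqrt n ^ 2 ≤ n := Nat.sqrt_le' n
  -- Since `n` exceeds the last square by at most `2 √n`, the sum changes by at most `2 √n C` in
  -- between, which is `o(n)`.
  have hs2 : n ≤ Nat.sqrt n ^ 2 + 2 * Nat.sqrt n := by
    have := Nat.sqrt_le_add n
    nlinarith
  have hs0 : 0 < Nat.sqrt n := Nat.sqrt_pos.2 hn
  simp only [Function.comp_apply]
  generalize Nat.sqrt n = a at hs0 hs1 hs2
  obtain ⟨b, rfl⟩ := Nat.exists_eq_add_of_le hs1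
  have hb : (b : ℝ) ≤ 2 * a := by exact_mod_cast (by omega : b ≤ 2 * a)
  have ha : (0 : ℝ) < a := by exact_mod_cast hs0
  have h2 := hinc (a ^ 2) b
  have h3 : |S (a ^ 2 + b)| ≤ |S (a ^ 2)| + 2 * a * C := by
    have := abs_sub_abs_le_abs_sub (S (a ^ 2 + b)) (S (a ^ 2))
    nlinarith
  rw [Real.norm_eq_abs, abs_div, abs_div, abs_of_nonneg (sq_nonneg (a : ℝ)),
    abs_of_nonneg (Nat.cast_nonneg (a ^ 2 + b) : (0 : ℝ) ≤ _)]
  have hden : (a : ℝ) ^ 2 ≤ ((a ^ 2 + b : ℕ) : ℝ) := by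
    push_cast
    linarith [Nat.cast_nonneg (α := ℝ) b]
  calc _ ≤ (|S (a ^ 2)| + 2 * a * C) / ((a ^ 2 + b : ℕ) : ℝ) := by gcongr
    _ ≤ (|S (a ^ 2)| + 2 * a * C) / (a : ℝ) ^ 2 := by gcongr
    _ = _ := by field_simp

/-- At time `(n + 1) ^ 2` the mean square of the average is at most `C ^ 2 / (n + 1) ^ 2`, which is
summable. This gives convergence along the squares, and bounded increments fill the gaps. -/
theorem ae_tendsto_sumCost_div (p01 p11 : I)
    {c : (Fin N → I) → Finset (Fin N) → Finset (Fin N) → ℝ} {C : ℝ}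
    (hc : ∀ ω s g, |c ω s g| ≤ C)
    (h0 : ∀ ω s, ∑ g ∈ s.powerset, outcomeProb ω s g * c ω s g = 0) (π : Policy N k)
    (ω : Fin N → I) :
    ∀ᵐ x ∂(channelLaw p01 p11 ω),
      Tendsto (fun T : ℕ => sumCost p01 p11 c 1 π ω T x / T) atTop (𝓝 0) := by
  have hm : ∀ n : ℕ, Measurable fun x =>
      (sumCost p01 p11 c 1 π ω ((n + 1) ^ 2) x / ((n + 1 : ℝ) ^ 2)) ^ 2 := fun n =>
    ((measurable_sumCost p01 p11 c 1 π ω _).div_const _).pow_const 2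
  have hi : ∀ n : ℕ, Integrable (fun x =>
      (sumCost p01 p11 c 1 π ω ((n + 1) ^ 2) x / ((n + 1 : ℝ) ^ 2)) ^ 2)
        (channelLaw p01 p11 ω) := by
    intro n
    refine Integrable.of_bound (hm n).aestronglyMeasurable
      (((∑ t ∈ Finset.range ((n + 1) ^ 2), |(1 : ℝ)| ^ t * C) / ((n + 1 : ℝ) ^ 2)) ^ 2)
      (Eventually.of_forall fun x => ?_)
    rw [Real.norm_eq_abs, abs_pow, abs_div, abs_of_nonneg (sq_nonneg (n + 1 : ℝ))]
    have := abs_sumCost_le p01 p11 1 hc π ω ((n + 1) ^ 2) x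
    gcongr
  have hsum : Summable fun n : ℕ => ∫ x,
      (sumCost p01 p11 c 1 π ω ((n + 1) ^ 2) x / ((n + 1 : ℝ) ^ 2)) ^ 2
        ∂(channelLaw p01 p11 ω) := by
    have hbase : Summable fun n : ℕ => C ^ 2 * (1 / ((n + 1 : ℕ) : ℝ) ^ 2) :=
      ((summable_nat_add_iff 1).2 (Real.summable_one_div_nat_pow.2 one_lt_two)).mul_left _
    refine Summable.of_nonneg_of_le (fun n => integral_nonneg fun x => sq_nonneg _) (fun n => ?_)
      hbase
    have h1 := integral_sumCost_sq_le p01 p11 hc h0 π ω ((n + 1) ^ 2)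
    simp only [div_pow]
    rw [integral_div]
    calc _ ≤ (((n + 1) ^ 2 : ℕ) : ℝ) * C ^ 2 / ((n + 1 : ℝ) ^ 2) ^ 2 := by gcongr
      _ = _ := by push_cast; field_simp
  filter_upwards [ae_tendsto_zero_of_summable_integral hm hi (fun n x => sq_nonneg _) hsum]
    with x hx
  refine tendsto_div_of_tendsto_sq (C := C) (fun n => ?_) ?_
  · simp only [sumCost, Finset.sum_range_succ, one_pow, one_mul, add_sub_cancel_left]
    exact hc _ _ _
  · have h2 := hx.sqrt
    simp only [Real.sqrt_sq_eq_abs, Real.sqrt_zero] at h2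
    exact (tendsto_zero_iff_abs_tendsto_zero _).2 h2

/-! ### Expectations over outcomes and Poisson binomial expectations -/

theorem sum_outcomeProb_card (ω : Fin N → I) (s : Finset (Fin N)) (F : ℕ → ℝ) {l : List ℝ}
    (hl : l.Perm (s.toList.map fun i => (ω i : ℝ))) :
    ∑ g ∈ s.powerset, outcomeProb ω s g * F g.card = binExp l F := by
  rw [binExp_perm hl]
  clear hl l
  induction s using Finset.induction_on generalizing F with
  | empty => simp [outcomeProb, binExp]
  | insert a s ha ih =>
    rw [binExp_perm ((Finset.toList_insert ha).map _), List.map_cons, binExp, ← ih, ← ih,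
      sum_outcomeProb_insert ω ha]
    congr 2
    refine Finset.sum_congr rfl fun g hg => ?_
    rw [Finset.card_insert_of_notMem fun h => ha (Finset.mem_powerset.1 hg h)]

theorem expectedReward_eq_binExp (m : ℕ) (ω : Fin N → I) (s : Finset (Fin N)) {l : List ℝ}
    (hl : l.Perm (s.toList.map fun i => (ω i : ℝ))) :
    expectedReward m s ω = binExp l fun j => ((min m j : ℕ) : ℝ) :=
  sum_outcomeProb_card ω s (fun j => ((min m j : ℕ) : ℝ)) hl

theorem expectedReward_update_sub (m : ℕ) (ω : Fin N → I) {s : Finset (Fin N)} {i : Fin N}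
    {js : List (Fin N)} (hjs : (i :: js).Perm s.toList) :
    expectedReward m s (Function.update ω i 1) - expectedReward m s (Function.update ω i 0) =
      binExp (js.map fun j => (ω j : ℝ))
        (fun j => ((min m (j + 1) : ℕ) : ℝ) - ((min m j : ℕ) : ℝ)) := by
  have hi : i ∉ js := (List.nodup_cons.1 (hjs.nodup_iff.2 s.nodup_toList)).1
  have key : ∀ c : I, ((c : ℝ) :: js.map fun j => (ω j : ℝ)).Perm
      (s.toList.map fun j => ((Function.update ω i c j : I) : ℝ)) := by
    intro c
    refine List.Perm.trans (List.Perm.of_eq ?_) (hjs.map _)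
    rw [List.map_cons, Function.update_self]
    congr 1
    refine List.map_congr_left fun j hj => ?_
    rw [Function.update_of_ne]
    rintro rfl
    exact hi hj
  rw [expectedReward_eq_binExp m _ s (key 1), expectedReward_eq_binExp m _ s (key 0), binExp_sub]
  simp [binExp]

theorem min_succ_sub_mem (m j : ℕ) :
    ((min m (j + 1) : ℕ) : ℝ) - ((min m j : ℕ) : ℝ) ∈ Set.Icc (0 : ℝ) 1 := by
  have h1 : min m j ≤ min m (j + 1) := by omega
  have h2 : min m (j + 1) ≤ min m j + 1 := by omega
  have h1' : ((min m j : ℕ) : ℝ) ≤ ((min m (j + 1) : ℕ) : ℝ) := by exact_mod_cast h1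
  have h2' : ((min m (j + 1) : ℕ) : ℝ) ≤ ((min m j : ℕ) : ℝ) + 1 := by exact_mod_cast h2
  constructor <;> linarith

theorem marginalGains_subset (N k m : ℕ) (p01 p11 : I) :
    marginalGains N k m p01 p11 ⊆ Set.Icc 0 1 := by
  rintro r ⟨i, hi, ω, -, rfl⟩
  have hperm : (i :: ((firstChannels N k).erase i).toList).Perm (firstChannels N k).toList := by
    have := Finset.toList_insert (Finset.notMem_erase i (firstChannels N k))
    rw [Finset.insert_erase hi] at this
    exact this.symm
  rw [expectedReward_update_sub m ω hperm]
  have hunit : ∀ x ∈ ((firstChannels N k).erase i).toList.map fun j => (ω j : ℝ),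
      x ∈ Set.Icc (0 : ℝ) 1 := by
    intro x hx
    obtain ⟨j, -, rfl⟩ := List.mem_map.1 hx
    exact (ω j).2
  constructor
  · conv_lhs => rw [← binExp_const (((firstChannels N k).erase i).toList.map fun j => (ω j : ℝ)) 0]
    exact binExp_mono hunit fun j _ => (min_succ_sub_mem m j).1
  · conv_rhs => rw [← binExp_const (((firstChannels N k).erase i).toList.map fun j => (ω j : ℝ)) 1]
    exact binExp_mono hunit fun j _ => (min_succ_sub_mem m j).2

theorem binExp_mem_marginalGains (m : ℕ) (hkN : k ≤ N) (p01 p11 : I) (hp : p01 ≤ p11)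
    {u : List ℝ} (hu : ∀ x ∈ u, x ∈ Set.Icc (p01 : ℝ) p11) (hlen : u.length + 1 = k) :
    binExp u (fun j => ((min m (j + 1) : ℕ) : ℝ) - ((min m j : ℕ) : ℝ)) ∈
      marginalGains N k m p01 p11 := by
  let v : Fin u.length → I := fun j => ⟨u.get j, p01.2.1.trans (hu _ (u.get_mem j)).1,
    (hu _ (u.get_mem j)).2.trans p11.2.2⟩
  -- Channel `0` is the one whose state varies; the entries of `u` sit on channels `1, …, k - 1`,
  -- and the irrelevant rest get `p01`.
  let ω : Fin N → I := fun j =>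
    if h : 1 ≤ j.val ∧ j.val - 1 < u.length then v ⟨j.val - 1, h.2⟩ else p01
  let i : Fin N := ⟨0, by omega⟩
  let f : Fin u.length → Fin N := fun j => ⟨j.val + 1, by omega⟩
  have hperm : (i :: List.ofFn f).Perm (firstChannels N k).toList := by
    refine List.perm_of_nodup_nodup_toFinset_eq (List.nodup_cons.2 ⟨?_, ?_⟩)
      (Finset.nodup_toList _) ?_
    · rw [List.mem_ofFn]
      rintro ⟨j, hj⟩
      simp [f, i, Fin.ext_iff] at hj
    · refine List.nodup_ofFn.2 fun a b hab => ?_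
      simpa [f, Fin.ext_iff] using hab
    · ext j
      simp only [List.mem_toFinset, List.mem_cons, List.mem_ofFn, Finset.mem_toList,
        firstChannels, Finset.mem_filter, Finset.mem_univ, true_and]
      constructor
      · rintro (rfl | ⟨a, rfl⟩)
        · simp [i]; omega
        · simp only [f]; omega
      · intro hj
        rcases Nat.eq_zero_or_pos j.val with h0 | h0
        · exact Or.inl (Fin.ext h0)
        · exact Or.inr ⟨⟨j.val - 1, by omega⟩, Fin.ext (by simp [f]; omega)⟩
  have hmap : (List.ofFn f).map (fun j => (ω j : ℝ)) = u := by
    rw [List.map_ofFn]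
    conv_rhs => rw [← List.ofFn_get u]
    congr 1
    funext j
    simp [f, ω, v]
  refine ⟨i, by simp [firstChannels, i]; omega, ω, fun j => ?_, ?_⟩
  · simp only [ω]
    split_ifs with h
    · exact hu _ (u.get_mem _)
    · exact ⟨le_rfl, hp⟩
  · rw [expectedReward_update_sub m ω hperm, hmap]

/-- The constant `D` is the fixed point of `D = Rmax + δ D`; with it, `δ D ≤ Rmin` is the ratio
hypothesis with denominators cleared. -/
theorem myopicData_of_lt (m : ℕ) (hkN : k ≤ N) (p01 p11 : I) (hp : p01 ≤ p11)
    (hδ : (p11 : ℝ) - p01 < 1)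
    (hcond : ((p11 : ℝ) - p01) / (1 - ((p11 : ℝ) - p01)) <
      Rmin N k m p01 p11 / Rmax N k m p01 p11) {β : ℝ} (hβ : 0 ≤ β) (hβ1 : β ≤ 1) :
    MyopicData k m p01 p11 β (Rmin N k m p01 p11) (Rmax N k m p01 p11)
      (Rmax N k m p01 p11 / (1 - ((p11 : ℝ) - p01))) := by
  have hpq : (p01 : ℝ) ≤ p11 := hp
  have hsub := marginalGains_subset N k m p01 p11
  have hR0 : 0 ≤ Rmax N k m p01 p11 := Real.sSup_nonneg fun x hx => (hsub hx).1
  have hδ' : 0 < 1 - ((p11 : ℝ) - p01) := by linarith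
  -- Positivity is implied: division by zero gives `0`, which is not larger than the nonnegative
  -- left side of `hcond`.
  have hR : 0 < Rmax N k m p01 p11 := by
    refine hR0.lt_of_ne fun h => ?_
    rw [← h, div_zero] at hcond
    exact absurd hcond (not_lt.2 (div_nonneg (sub_nonneg.2 hpq) hδ'.le))
  refine ⟨p01.2.1, hpq, p11.2.2, hβ, hβ1, by positivity, hR0, ?_, ?_, ?_⟩
  · rw [lt_div_iff₀ hR] at hcond
    calc _ = ((p11 : ℝ) - p01) / (1 - ((p11 : ℝ) - p01)) * Rmax N k m p01 p11 := by ring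
      _ ≤ _ := hcond.le
  · apply le_of_eq
    field_simp
    ring
  · intro u hu hlen
    have h := binExp_mem_marginalGains m hkN p01 p11 hp hu hlen
    exact ⟨csInf_le ⟨0, fun x hx => (hsub hx).1⟩ h, le_csSup ⟨1, fun x hx => (hsub hx).2⟩ h⟩

/-! ### The finite-horizon value as a function of the belief vector -/

/-- The beliefs in decreasing order. -/
def sortedBeliefs (ω : Fin N → I) : List ℝ :=
  (Finset.univ.toList.map fun i => (ω i : ℝ)).insertionSort (· ≥ ·)

theorem insertionSort_eq_sortedBeliefs (ω : Fin N → I) {l : List ℝ}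
    (hl : l.Perm (Finset.univ.toList.map fun i => (ω i : ℝ))) :
    l.insertionSort (· ≥ ·) = sortedBeliefs ω :=
  List.Perm.eq_of_pairwise' (List.pairwise_insertionSort _ _) (List.pairwise_insertionSort _ _)
    ((List.perm_insertionSort _ _).trans (hl.trans (List.perm_insertionSort _ _).symm))

/-- A decreasing arrangement is unique as a list of numbers, which is why tie-breaking is
immaterial. -/
theorem eq_sortedBeliefs (ω : Fin N → I) {l : List ℝ}
    (hl : l.Perm (Finset.univ.toList.map fun i => (ω i : ℝ))) (hs : l.Pairwise (· ≥ ·)) :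
    l = sortedBeliefs ω :=
  List.Perm.eq_of_pairwise' hs (List.pairwise_insertionSort _ _)
    (hl.trans (List.perm_insertionSort _ _).symm)

theorem length_sortedBeliefs (ω : Fin N → I) : (sortedBeliefs ω).length = N := by
  simp [sortedBeliefs, List.length_insertionSort]

theorem mem_sortedBeliefs (ω : Fin N → I) {x : ℝ} (hx : x ∈ sortedBeliefs ω) :
    ∃ i, x = ω i := by
  have := (List.perm_insertionSort _ _).mem_iff.1 hx
  obtain ⟨i, -, rfl⟩ := List.mem_map.1 this
  exact ⟨i, rfl⟩

/-- The beliefs of the channels in `s` in decreasing order. -/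
def sortedOn (ω : Fin N → I) (s : Finset (Fin N)) : List ℝ :=
  (s.toList.map fun i => (ω i : ℝ)).insertionSort (· ≥ ·)

theorem sortedOn_perm (ω : Fin N → I) (s : Finset (Fin N)) :
    (sortedOn ω s).Perm (s.toList.map fun i => (ω i : ℝ)) := List.perm_insertionSort _ _

theorem mem_sortedOn {ω : Fin N → I} {s : Finset (Fin N)} {x : ℝ} (hx : x ∈ sortedOn ω s) :
    ∃ i ∈ s, x = ω i := by
  obtain ⟨i, hi, rfl⟩ := List.mem_map.1 ((sortedOn_perm ω s).mem_iff.1 hx)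
  exact ⟨i, Finset.mem_toList.1 hi, rfl⟩

theorem sortedOn_append_compl_perm (ω : Fin N → I) (s : Finset (Fin N)) :
    (sortedOn ω s ++ sortedOn ω sᶜ).Perm (Finset.univ.toList.map fun i => (ω i : ℝ)) := by
  refine ((sortedOn_perm ω s).append (sortedOn_perm ω sᶜ)).trans ?_
  rw [← List.map_append]
  refine List.Perm.map _ (List.perm_of_nodup_nodup_toFinset_eq ?_ (Finset.nodup_toList _) ?_)
  · rw [List.nodup_append']
    refine ⟨Finset.nodup_toList _, Finset.nodup_toList _, ?_⟩
    intro i hi hi'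
    simp_all
  · ext i; simp

theorem pairwise_nextList {p q : ℝ} (hpq : p ≤ q) {l : List ℝ}
    (hl : ∀ x ∈ l, x ∈ Set.Icc (0 : ℝ) 1) (hs : l.Pairwise (· ≥ ·)) (j : ℕ) :
    (nextList k p q j l).Pairwise (· ≥ ·) := by
  have hτ : ∀ y ∈ l.map (tauReal p q), y ∈ Set.Icc p q := by
    intro y hy
    obtain ⟨x, hx, rfl⟩ := List.mem_map.1 hy
    exact tauReal_mem hpq (hl x hx)
  unfold nextList
  refine List.pairwise_append.2 ⟨List.pairwise_replicate.2 (Or.inr le_rfl),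
    List.pairwise_append.2 ⟨?_, List.pairwise_replicate.2 (Or.inr le_rfl), ?_⟩, ?_⟩
  · refine List.pairwise_map.2 (hs.imp fun {a b} hab => ?_)
    have hab : b ≤ a := hab
    change tauReal p q b ≤ tauReal p q a
    unfold tauReal
    nlinarith
  · intro a ha b hb
    rw [List.eq_of_mem_replicate hb]
    exact (hτ a ha).1
  · intro a ha b hb
    rw [List.eq_of_mem_replicate ha]
    rcases List.mem_append.1 hb with hb | hb
    · exact (hτ b hb).2
    · rw [List.eq_of_mem_replicate hb]
      exact hpq

/-- Updated unsensed beliefs stay between `p01` and `p11` in the same order, so the list is sorted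
without comparing anything, and it depends on `g` only through its cardinality. -/
theorem sortedBeliefs_nextBelief (p01 p11 : I) (hp : p01 ≤ p11) (ω : Fin N → I)
    {s g : Finset (Fin N)} (hs : s.card = k) (hg : g ⊆ s) :
    sortedBeliefs (nextBelief p01 p11 ω s g) = nextList k p01 p11 g.card (sortedOn ω sᶜ) := by
  symm
  refine eq_sortedBeliefs _ ?_ (pairwise_nextList hp (fun x hx => ?_)
    (List.pairwise_insertionSort _ _) _)
  · have h1 : (g.toList ++ (sᶜ.toList ++ (s \ g).toList)).Perm
        (Finset.univ : Finset (Fin N)).toList := by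
      refine List.perm_of_nodup_nodup_toFinset_eq ?_ (Finset.nodup_toList _) ?_
      · rw [List.nodup_append', List.nodup_append']
        refine ⟨Finset.nodup_toList _, ⟨Finset.nodup_toList _, Finset.nodup_toList _, ?_⟩, ?_⟩
        · intro i hi hi'
          simp_all
        · intro i hi hi'
          have := hg (Finset.mem_toList.1 hi)
          simp_all
      · ext i
        simp only [List.toFinset_append, Finset.toList_toFinset, Finset.mem_union,
          Finset.mem_compl, Finset.mem_sdiff, Finset.mem_univ, iff_true]
        tauto
    refine List.Perm.trans ?_ (h1.map _)
    rw [List.map_append, List.map_append, nextList]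
    have e1 : g.toList.map (fun i => (nextBelief p01 p11 ω s g i : ℝ)) =
        List.replicate g.card (p11 : ℝ) := by
      rw [List.eq_replicate_iff]
      refine ⟨by simp, fun b hb => ?_⟩
      obtain ⟨i, hi, rfl⟩ := List.mem_map.1 hb
      have hi := Finset.mem_toList.1 hi
      simp [nextBelief, posterior, hi, hg hi, tau_one]
    have e2 : (s \ g).toList.map (fun i => (nextBelief p01 p11 ω s g i : ℝ)) =
        List.replicate (k - g.card) (p01 : ℝ) := by
      rw [List.eq_replicate_iff]
      refine ⟨by simp [Finset.card_sdiff_of_subset hg, hs], fun b hb => ?_⟩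
      obtain ⟨i, hi, rfl⟩ := List.mem_map.1 hb
      have hi := Finset.mem_sdiff.1 (Finset.mem_toList.1 hi)
      simp [nextBelief, posterior, hi.1, hi.2, tau_zero]
    have e3 : sᶜ.toList.map (fun i => (nextBelief p01 p11 ω s g i : ℝ)) =
        (sᶜ.toList.map fun i => (ω i : ℝ)).map (tauReal p01 p11) := by
      rw [List.map_map]
      refine List.map_congr_left fun i hi => ?_
      have hi := Finset.mem_compl.1 (Finset.mem_toList.1 hi)
      simp [nextBelief, posterior, hi, tau, tauReal]
    rw [e1, e2, e3]
    exact ((sortedOn_perm ω sᶜ).map _).append_right _ |>.append_left _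
  · obtain ⟨i, -, rfl⟩ := mem_sortedOn hx
    exact (ω i).2

/-- The `n`-step value of the beliefs taken in decreasing order. -/
def sortedValue (k m : ℕ) (p01 p11 : I) (β : ℝ) (n : ℕ) (ω : Fin N → I) : ℝ :=
  listValue k m p01 p11 β n (sortedBeliefs ω)

/-- This translates the choice of a sensing set into the choice of an order of the list. -/
theorem sum_outcomeProb_sortedValue (m : ℕ) (p01 p11 : I) (hp : p01 ≤ p11) (β : ℝ) (n : ℕ)
    (ω : Fin N → I) {s : Finset (Fin N)} (hs : s.card = k) :
    ∑ g ∈ s.powerset, outcomeProb ω s g * (((min m g.card : ℕ) : ℝ) +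
        β * sortedValue k m p01 p11 β n (nextBelief p01 p11 ω s g)) =
      listValue k m p01 p11 β (n + 1) (sortedOn ω s ++ sortedOn ω sᶜ) := by
  rw [listValue_append n (by rw [(sortedOn_perm ω s).length_eq]; simpa using hs),
    ← sum_outcomeProb_card ω s _ (sortedOn_perm ω s)]
  refine Finset.sum_congr rfl fun g hg => ?_
  rw [sortedValue, sortedBeliefs_nextBelief p01 p11 hp ω hs (Finset.mem_powerset.1 hg)]

/-! ### The Bellman equation and the discounted problem -/

section Bellman

variable {m : ℕ} {p01 p11 : I} {β r R D : ℝ}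

theorem MyopicData.bellman_le (h : MyopicData k m p01 p11 β r R D) (hkN : k ≤ N) (n : ℕ)
    {ω : Fin N → I} (hω : ∀ i, ω i ∈ Set.Icc p01 p11) {s : Finset (Fin N)} (hs : s.card = k) :
    ∑ g ∈ s.powerset, outcomeProb ω s g * (((min m g.card : ℕ) : ℝ) +
        β * sortedValue k m p01 p11 β n (nextBelief p01 p11 ω s g)) ≤
      sortedValue k m p01 p11 β (n + 1) ω := by
  rw [sum_outcomeProb_sortedValue m p01 p11 h.hpq β n ω hs, sortedValue,
    ← insertionSort_eq_sortedBeliefs ω (sortedOn_append_compl_perm ω s)]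
  refine h.le_insertionSort (n + 1) (u := []) (by simp) ?_ ?_
  · intro x hx
    obtain ⟨i, -, rfl⟩ := List.mem_map.1 ((sortedOn_append_compl_perm ω s).mem_iff.1 hx)
    exact hω i
  · have hlen := (sortedOn_append_compl_perm ω s).length_eq
    simp only [List.length_map, Finset.length_toList, Finset.card_univ, Fintype.card_fin] at hlen
    exact (hkN.trans hlen.ge).trans (Nat.le_add_left _ _)

theorem MyopicData.bellman_eq (h : MyopicData k m p01 p11 β r R D) (n : ℕ)
    (ω : Fin N → I) {s : Finset (Fin N)} (hs : s.card = k)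
    (hmax : ∀ i ∈ s, ∀ j ∉ s, ω j ≤ ω i) :
    ∑ g ∈ s.powerset, outcomeProb ω s g * (((min m g.card : ℕ) : ℝ) +
        β * sortedValue k m p01 p11 β n (nextBelief p01 p11 ω s g)) =
      sortedValue k m p01 p11 β (n + 1) ω := by
  rw [sum_outcomeProb_sortedValue m p01 p11 h.hpq β n ω hs, sortedValue,
    eq_sortedBeliefs ω (sortedOn_append_compl_perm ω s)]
  refine List.pairwise_append.2 ⟨List.pairwise_insertionSort _ _,
    List.pairwise_insertionSort _ _, ?_⟩
  intro a ha b hb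
  obtain ⟨i, hi, rfl⟩ := mem_sortedOn ha
  obtain ⟨j, hj, rfl⟩ := mem_sortedOn hb
  exact hmax i hi j (Finset.mem_compl.1 hj)

theorem nextBelief_mem (hp : p01 ≤ p11) (ω : Fin N → I) (s g : Finset (Fin N)) (i : Fin N) :
    nextBelief p01 p11 ω s g i ∈ Set.Icc p01 p11 :=
  tauReal_mem (p := p01) (q := p11) hp (posterior ω s g i).2

/-- The reward as a step cost. -/
def rewardCost (m : ℕ) : (Fin N → I) → Finset (Fin N) → Finset (Fin N) → ℝ :=
  fun _ _ g => ((min m g.card : ℕ) : ℝ)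

theorem rewardCost_mem (m : ℕ) (ω : Fin N → I) (s g : Finset (Fin N)) :
    rewardCost m ω s g ∈ Set.Icc (0 : ℝ) m :=
  ⟨Nat.cast_nonneg _, by unfold rewardCost; exact_mod_cast min_le_left m _⟩

theorem abs_rewardCost_le (m : ℕ) (ω : Fin N → I) (s g : Finset (Fin N)) :
    |rewardCost m ω s g| ≤ m := by
  rw [abs_of_nonneg (rewardCost_mem m ω s g).1]
  exact (rewardCost_mem m ω s g).2

theorem reward_eq_stepCost (m : ℕ) (p01 p11 : I) (π : Policy N k) (ω : Fin N → I)
    (x : Fin N → ℕ → Bool) (t : ℕ) :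
    reward m p01 p11 π ω x t = stepCost p01 p11 (rewardCost m) π ω x t := rfl

theorem MyopicData.integral_sumCost_le (h : MyopicData k m p01 p11 β r R D) (hkN : k ≤ N)
    (π : Policy N k) (n : ℕ) {ω : Fin N → I} (hω : ∀ i, ω i ∈ Set.Icc p01 p11) :
    ∫ x, sumCost p01 p11 (rewardCost m) β π ω n x ∂(channelLaw p01 p11 ω) ≤
      sortedValue k m p01 p11 β n ω := by
  induction n generalizing π ω with
  | zero => simp [sumCost, sortedValue, listValue]
  | succ n ih =>
    rw [integral_sumCost_succ p01 p11 β (abs_rewardCost_le m)]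
    refine le_trans (Finset.sum_le_sum fun g _ => mul_le_mul_of_nonneg_left ?_
      (outcomeProb_nonneg _ _ _)) (h.bellman_le hkN n hω (π 0 ω).2)
    exact add_le_add le_rfl (mul_le_mul_of_nonneg_left
      (ih _ fun i => nextBelief_mem h.hpq ω _ _ i) h.hβ)

theorem MyopicData.integral_sumCost_eq (h : MyopicData k m p01 p11 β r R D)
    {π : Policy N k} (hπ : IsMyopic π) (n : ℕ) (ω : Fin N → I) :
    ∫ x, sumCost p01 p11 (rewardCost m) β π ω n x ∂(channelLaw p01 p11 ω) =
      sortedValue k m p01 p11 β n ω := by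
  induction n generalizing π ω with
  | zero => simp [sumCost, sortedValue, listValue]
  | succ n ih =>
    rw [integral_sumCost_succ p01 p11 β (abs_rewardCost_le m),
      ← h.bellman_eq n ω (π 0 ω).2 (hπ 0 ω)]
    refine Finset.sum_congr rfl fun g _ => ?_
    rw [ih (π := Policy.tail π) (fun t => hπ (t + 1))]
    rfl

theorem tendsto_integral_sumCost (m : ℕ) (p01 p11 : I) {β : ℝ} (hβ : 0 < β) (hβ1 : β < 1)
    (π : Policy N k) (ω : Fin N → I) :
    Tendsto (fun n => ∫ x, sumCost p01 p11 (rewardCost m) β π ω n x ∂(channelLaw p01 p11 ω))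
      atTop (𝓝 (discountedValue m p01 p11 β π ω)) := by
  have hsum : Summable fun t : ℕ => |β| ^ t * (m : ℝ) :=
    (summable_geometric_of_lt_one (abs_nonneg β) (by rwa [abs_of_pos hβ])).mul_right _
  refine tendsto_integral_filter_of_norm_le_const ?_ ?_ ?_
  · exact Eventually.of_forall fun n =>
      (measurable_sumCost p01 p11 _ β π ω n).aestronglyMeasurable
  · refine ⟨_, Eventually.of_forall fun n => Eventually.of_forall fun x =>
      (abs_sumCost_le p01 p11 β (abs_rewardCost_le m) π ω n x).trans
        (hsum.sum_le_tsum _ fun t _ => by positivity)⟩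
  · refine Eventually.of_forall fun x => ?_
    have hs : Summable fun t => β ^ t * reward m p01 p11 π ω x t := by
      refine Summable.of_norm_bounded hsum fun t => ?_
      rw [norm_mul, norm_pow, Real.norm_eq_abs, Real.norm_eq_abs, reward_eq_stepCost, stepCost]
      exact mul_le_mul_of_nonneg_left (abs_rewardCost_le m _ _ _) (by positivity)
    exact hs.hasSum.tendsto_sum_nat

theorem MyopicData.isDiscountedOptimal (h : MyopicData k m p01 p11 β r R D) (hkN : k ≤ N)
    (hβ : 0 < β) (hβ1 : β < 1) {π : Policy N k} (hπ : IsMyopic π) {ω : Fin N → I}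
    (hω : ∀ i, ω i ∈ Set.Icc p01 p11) : IsDiscountedOptimal m p01 p11 β π ω := by
  intro π'
  -- The finite-horizon comparison holds at every `n`, and truncated values converge to discounted
  -- ones.
  refine le_of_tendsto_of_tendsto' (tendsto_integral_sumCost m p01 p11 hβ hβ1 π' ω)
    (tendsto_integral_sumCost m p01 p11 hβ hβ1 π ω) fun n => ?_
  rw [h.integral_sumCost_eq hπ]
  exact h.integral_sumCost_le hkN π' n hω

end Bellman

/-! ### The long-run average -/

section TimeAverage

variable {m : ℕ} {p01 p11 : I}

theorem timeAverage_eq (π : Policy N k) (ω : Fin N → I) (x : Fin N → ℕ → Bool) (T : ℕ) :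
    timeAverage m p01 p11 π ω x T = sumCost p01 p11 (rewardCost m) 1 π ω T x / T := by
  simp only [timeAverage, sumCost, one_pow, one_mul, reward_eq_stepCost]
  ring

theorem timeAverage_mem (π : Policy N k) (ω : Fin N → I) (x : Fin N → ℕ → Bool) (T : ℕ) :
    timeAverage m p01 p11 π ω x T ∈ Set.Icc (0 : ℝ) m := by
  rw [timeAverage_eq]
  have h1 : 0 ≤ sumCost p01 p11 (rewardCost m) 1 π ω T x :=
    Finset.sum_nonneg fun t _ => by
      rw [one_pow, one_mul]; exact (rewardCost_mem m _ _ _).1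
  have h2 := (le_abs_self _).trans
    (abs_sumCost_le p01 p11 1 (abs_rewardCost_le m) π ω T x)
  simp only [abs_one, one_pow, one_mul, Finset.sum_const, Finset.card_range, nsmul_eq_mul] at h2
  refine ⟨div_nonneg h1 (Nat.cast_nonneg _), div_le_of_le_mul₀ (Nat.cast_nonneg _)
    (Nat.cast_nonneg _) ?_⟩
  linarith

theorem isBoundedUnder_le_timeAverage (π : Policy N k) (ω : Fin N → I)
    (x : Fin N → ℕ → Bool) :
    IsBoundedUnder (· ≤ ·) atTop (timeAverage m p01 p11 π ω x) :=
  isBoundedUnder_of ⟨m, fun T => (timeAverage_mem π ω x T).2⟩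

theorem isBoundedUnder_ge_timeAverage (π : Policy N k) (ω : Fin N → I)
    (x : Fin N → ℕ → Bool) :
    IsBoundedUnder (· ≥ ·) atTop (timeAverage m p01 p11 π ω x) :=
  isBoundedUnder_of ⟨0, fun T => (timeAverage_mem π ω x T).1⟩

theorem limsup_timeAverage_mem (π : Policy N k) (ω : Fin N → I) (x : Fin N → ℕ → Bool) :
    limsup (timeAverage m p01 p11 π ω x) atTop ∈ Set.Icc (0 : ℝ) m :=
  ⟨le_limsup_of_frequently_le (Frequently.of_forall fun T => (timeAverage_mem π ω x T).1)
      (isBoundedUnder_le_timeAverage π ω x),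
    limsup_le_of_le (isBoundedUnder_ge_timeAverage π ω x).isCoboundedUnder_le
      (Eventually.of_forall fun T => (timeAverage_mem π ω x T).2)⟩

theorem integrable_limsup_timeAverage (π : Policy N k) (ω : Fin N → I) :
    Integrable (fun x => limsup (timeAverage m p01 p11 π ω x) atTop)
      (channelLaw p01 p11 ω) := by
  refine Integrable.of_bound (C := m) (Measurable.aestronglyMeasurable ?_)
    (Eventually.of_forall fun x => ?_)
  · refine Measurable.limsup fun T => ?_
    simp only [timeAverage_eq]
    exact (measurable_sumCost p01 p11 _ 1 π ω T).div_const _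
  · rw [Real.norm_eq_abs, abs_of_nonneg (limsup_timeAverage_mem π ω x).1]
    exact (limsup_timeAverage_mem π ω x).2

end TimeAverage

/-! ### Approximate solutions of the average-reward optimality equation -/

section Poisson

variable {m : ℕ} {p01 p11 : I} {r R D : ℝ}

/-- Expected one-step reward plus expected value of `h` at the next beliefs, when the channels in
`s` are sensed. -/
def lookahead (m : ℕ) (p01 p11 : I) (h : (Fin N → I) → ℝ) (ω : Fin N → I)
    (s : Finset (Fin N)) : ℝ :=
  ∑ g ∈ s.powerset, outcomeProb ω s g *
    (((min m g.card : ℕ) : ℝ) + h (nextBelief p01 p11 ω s g))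

/-- The deviation of the reward plus next value of `h` from its conditional expectation. -/
def deviation (m : ℕ) (p01 p11 : I) (h : (Fin N → I) → ℝ) (ω : Fin N → I)
    (s g : Finset (Fin N)) : ℝ :=
  ((min m g.card : ℕ) : ℝ) + h (nextBelief p01 p11 ω s g) - lookahead m p01 p11 h ω s

theorem sum_outcomeProb_deviation (m : ℕ) (p01 p11 : I) (h : (Fin N → I) → ℝ) (ω : Fin N → I)
    (s : Finset (Fin N)) :
    ∑ g ∈ s.powerset, outcomeProb ω s g * deviation m p01 p11 h ω s g = 0 := by
  simp only [deviation, mul_sub, Finset.sum_sub_distrib]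
  rw [← Finset.sum_mul, sum_outcomeProb, one_mul, ← lookahead, sub_self]

theorem abs_deviation_le {h : (Fin N → I) → ℝ} {B : ℝ} (hh : ∀ ω, h ω ∈ Set.Icc 0 B)
    (ω : Fin N → I) (s g : Finset (Fin N)) : |deviation m p01 p11 h ω s g| ≤ m + B := by
  have key : ∀ g : Finset (Fin N),
      ((min m g.card : ℕ) : ℝ) + h (nextBelief p01 p11 ω s g) ∈ Set.Icc (0 : ℝ) (m + B) := by
    intro g
    have h1 := rewardCost_mem m ω s g
    have h2 := hh (nextBelief p01 p11 ω s g)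
    exact ⟨add_nonneg h1.1 h2.1, add_le_add h1.2 h2.2⟩
  have hl : lookahead m p01 p11 h ω s ∈ Set.Icc (0 : ℝ) (m + B) := by
    refine ⟨Finset.sum_nonneg fun g _ => mul_nonneg (outcomeProb_nonneg _ _ _) (key g).1, ?_⟩
    calc lookahead m p01 p11 h ω s ≤ ∑ g ∈ s.powerset, outcomeProb ω s g * (m + B) :=
          Finset.sum_le_sum fun g _ =>
            mul_le_mul_of_nonneg_left (key g).2 (outcomeProb_nonneg _ _ _)
      _ = m + B := by rw [← Finset.sum_mul, sum_outcomeProb, one_mul]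
  rw [deviation, abs_le]
  constructor <;> linarith [(key g).1, (key g).2, hl.1, hl.2]

/-- Each reward is a centred deviation plus the lookahead minus `h` at the next belief. When the
lookahead is compared with `h` plus a constant, the `h` terms telescope. -/
theorem rewardCost_sum_succ (h : (Fin N → I) → ℝ) (π : Policy N k) (ω : Fin N → I)
    (x : Fin N → ℕ → Bool) (T : ℕ) :
    sumCost p01 p11 (rewardCost m) 1 π ω (T + 1) x - sumCost p01 p11 (rewardCost m) 1 π ω T x =
      sumCost p01 p11 (deviation m p01 p11 h) 1 π ω (T + 1) x -
        sumCost p01 p11 (deviation m p01 p11 h) 1 π ω T x +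
        lookahead m p01 p11 h (belief p01 p11 π ω x T) (π T (belief p01 p11 π ω x T)).1 -
        h (belief p01 p11 π ω x (T + 1)) := by
  simp only [sumCost, Finset.sum_range_succ, one_pow, one_mul, stepCost, rewardCost, deviation,
    belief_succ]
  ring

theorem belief_succ_mem (hp : p01 ≤ p11) (π : Policy N k) (ω : Fin N → I)
    (x : Fin N → ℕ → Bool) (t : ℕ) (i : Fin N) :
    belief p01 p11 π ω x (t + 1) i ∈ Set.Icc p01 p11 := by
  rw [belief_succ]
  exact nextBelief_mem hp _ _ _ i

/-- A bounded subsolution of the average-reward optimality equation bounds the long-run average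
reward of every policy. -/
theorem ae_limsup_timeAverage_le (hp : p01 ≤ p11) {h : (Fin N → I) → ℝ} {B a : ℝ}
    (hh : ∀ ω, h ω ∈ Set.Icc 0 B) (π : Policy N k)
    (ha : ∀ t ω, (∀ i, ω i ∈ Set.Icc p01 p11) → lookahead m p01 p11 h ω (π t ω).1 ≤ h ω + a)
    (ω : Fin N → I) :
    ∀ᵐ x ∂(channelLaw p01 p11 ω), limsup (timeAverage m p01 p11 π ω x) atTop ≤ a := by
  filter_upwards [ae_tendsto_sumCost_div p01 p11 (abs_deviation_le (m := m) (p01 := p01)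
    (p11 := p11) hh) (sum_outcomeProb_deviation m p01 p11 h) π ω] with x hx
  set S := fun T => sumCost p01 p11 (deviation m p01 p11 h) 1 π ω T x
  -- The initial belief may lie outside `[p01, p11]`, where `ha` says nothing. The constant `K`
  -- absorbs this first step; all later beliefs lie in the interval.
  set K := lookahead m p01 p11 h ω (π 0 ω).1 - a
  have key : ∀ T : ℕ, sumCost p01 p11 (rewardCost m) 1 π ω (T + 1) x ≤
      S (T + 1) + K - h (belief p01 p11 π ω x (T + 1)) + (T + 1 : ℕ) * a := by
    intro T
    induction T with
    | zero =>
      have h1 := rewardCost_sum_succ (m := m) h π ω x 0 (p01 := p01) (p11 := p11)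
      have e0 : ∀ c, sumCost p01 p11 c 1 π ω 0 x = 0 := fun c => Finset.sum_range_zero _
      have hb : belief p01 p11 π ω x 0 = ω := rfl
      rw [e0, e0, hb] at h1
      simp only [S, K, zero_add, Nat.cast_one] at h1 ⊢
      linarith
    | succ T ih =>
      have h1 := rewardCost_sum_succ (m := m) h π ω x (T + 1) (p01 := p01) (p11 := p11)
      have h2 := ha (T + 1) _ (belief_succ_mem hp π ω x T)
      push_cast at ih ⊢
      simp only [S] at ih ⊢
      linarith
  have hlim : Tendsto (fun T : ℕ => S T / T + K / T + a) atTop (𝓝 a) := by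
    simpa using (hx.add (tendsto_const_div_atTop_nhds_zero_nat K)).add_const a
  have hle : ∀ᶠ T : ℕ in atTop, timeAverage m p01 p11 π ω x T ≤ S T / T + K / T + a := by
    filter_upwards [eventually_ge_atTop 1] with T hT
    obtain ⟨T, rfl⟩ := Nat.exists_eq_add_of_le' hT
    have hT0 : (0 : ℝ) < ((T + 1 : ℕ) : ℝ) := by positivity
    rw [timeAverage_eq, ← add_div, div_add' _ _ _ hT0.ne']
    refine div_le_div_of_nonneg_right ?_ hT0.le
    linarith [key T, (hh (belief p01 p11 π ω x (T + 1))).1]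
  exact (limsup_le_limsup hle (isBoundedUnder_ge_timeAverage π ω x).isCoboundedUnder_le
    hlim.isBoundedUnder_le).trans hlim.limsup_eq.le

/-- A bounded supersolution of the average-reward evaluation equation of a policy bounds its
long-run average reward from below. -/
theorem ae_le_liminf_timeAverage (hp : p01 ≤ p11) {h : (Fin N → I) → ℝ} {B a : ℝ}
    (hh : ∀ ω, h ω ∈ Set.Icc 0 B) (π : Policy N k)
    (ha : ∀ t ω, (∀ i, ω i ∈ Set.Icc p01 p11) → h ω + a ≤ lookahead m p01 p11 h ω (π t ω).1)
    (ω : Fin N → I) :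
    ∀ᵐ x ∂(channelLaw p01 p11 ω), a ≤ liminf (timeAverage m p01 p11 π ω x) atTop := by
  filter_upwards [ae_tendsto_sumCost_div p01 p11 (abs_deviation_le (m := m) (p01 := p01)
    (p11 := p11) hh) (sum_outcomeProb_deviation m p01 p11 h) π ω] with x hx
  set S := fun T => sumCost p01 p11 (deviation m p01 p11 h) 1 π ω T x
  set K := lookahead m p01 p11 h ω (π 0 ω).1 - a
  have key : ∀ T : ℕ, S (T + 1) + K - h (belief p01 p11 π ω x (T + 1)) + (T + 1 : ℕ) * a ≤
      sumCost p01 p11 (rewardCost m) 1 π ω (T + 1) x := by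
    intro T
    induction T with
    | zero =>
      have h1 := rewardCost_sum_succ (m := m) h π ω x 0 (p01 := p01) (p11 := p11)
      have e0 : ∀ c, sumCost p01 p11 c 1 π ω 0 x = 0 := fun c => Finset.sum_range_zero _
      have hb : belief p01 p11 π ω x 0 = ω := rfl
      rw [e0, e0, hb] at h1
      simp only [S, K, zero_add, Nat.cast_one] at h1 ⊢
      linarith
    | succ T ih =>
      have h1 := rewardCost_sum_succ (m := m) h π ω x (T + 1) (p01 := p01) (p11 := p11)
      have h2 := ha (T + 1) _ (belief_succ_mem hp π ω x T)
      push_cast at ih ⊢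
      simp only [S] at ih ⊢
      linarith
  -- The last value of `h` now enters with the unfavourable sign and is bounded by `B`.
  have hlim : Tendsto (fun T : ℕ => S T / T + (K - B) / T + a) atTop (𝓝 a) := by
    simpa using (hx.add (tendsto_const_div_atTop_nhds_zero_nat (K - B))).add_const a
  have hle : ∀ᶠ T : ℕ in atTop, S T / T + (K - B) / T + a ≤ timeAverage m p01 p11 π ω x T := by
    filter_upwards [eventually_ge_atTop 1] with T hT
    obtain ⟨T, rfl⟩ := Nat.exists_eq_add_of_le' hT
    have hT0 : (0 : ℝ) < ((T + 1 : ℕ) : ℝ) := by positivity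
    rw [timeAverage_eq, ← add_div, div_add' _ _ _ hT0.ne']
    refine div_le_div_of_nonneg_right ?_ hT0.le
    linarith [key T, (hh (belief p01 p11 π ω x (T + 1))).2]
  exact hlim.liminf_eq.ge.trans (liminf_le_liminf hle hlim.isBoundedUnder_ge
    (isBoundedUnder_le_timeAverage π ω x).isCoboundedUnder_ge)

/-- Average of the values over the horizons `0, …, n`. -/
def relativeValue (k m : ℕ) (p01 p11 : I) (n : ℕ) (ω : Fin N → I) : ℝ :=
  (∑ j ∈ Finset.range (n + 1), sortedValue k m p01 p11 1 j ω) / (n + 1 : ℕ)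

/-- The bound grows with `n`, which is harmless: `n` is fixed while the time `T` tends to infinity.
-/
theorem relativeValue_mem (hp : p01 ≤ p11) (n : ℕ) (ω : Fin N → I) :
    relativeValue k m p01 p11 n ω ∈
      Set.Icc (0 : ℝ) ((∑ j ∈ Finset.range (n + 1), (j : ℝ) * m) / (n + 1 : ℕ)) := by
  have key : ∀ j : ℕ, sortedValue k m p01 p11 1 j ω ∈ Set.Icc (0 : ℝ) (j * m) := fun j =>
    listValue_mem p01.2.1 hp p11.2.2 zero_le_one le_rfl j fun x hx => by
      obtain ⟨i, rfl⟩ := mem_sortedBeliefs ω hx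
      exact (ω i).2
  exact ⟨div_nonneg (Finset.sum_nonneg fun j _ => (key j).1) (Nat.cast_nonneg _),
    div_le_div_of_nonneg_right (Finset.sum_le_sum fun j _ => (key j).2) (Nat.cast_nonneg _)⟩

theorem lookahead_relativeValue (n : ℕ) (ω : Fin N → I) (s : Finset (Fin N)) :
    lookahead m p01 p11 (relativeValue k m p01 p11 n) ω s =
      (∑ j ∈ Finset.range (n + 1), ∑ g ∈ s.powerset, outcomeProb ω s g *
        (((min m g.card : ℕ) : ℝ) +
          1 * sortedValue k m p01 p11 1 j (nextBelief p01 p11 ω s g))) / (n + 1 : ℕ) := by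
  rw [Finset.sum_comm, lookahead, Finset.sum_div]
  refine Finset.sum_congr rfl fun g _ => ?_
  have hn : ((n + 1 : ℕ) : ℝ) ≠ 0 := by positivity
  rw [← Finset.mul_sum, mul_div_assoc]
  congr 1
  simp only [one_mul, Finset.sum_add_distrib, Finset.sum_const, Finset.card_range, nsmul_eq_mul]
  rw [relativeValue, add_div, mul_div_cancel_left₀ _ hn]

/-- The two sums over horizons telescope, and the value at horizon zero vanishes. The remainder `V
(n + 1) / (n + 1)` plays the role of the optimal average reward. -/
theorem sum_sortedValue_succ (n : ℕ) (ω : Fin N → I) :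
    (∑ j ∈ Finset.range (n + 1), sortedValue k m p01 p11 1 (j + 1) ω) / (n + 1 : ℕ) =
      relativeValue k m p01 p11 n ω + sortedValue k m p01 p11 1 (n + 1) ω / (n + 1 : ℕ) := by
  have h := Finset.sum_range_succ' (fun j => sortedValue k m p01 p11 1 j ω) (n + 1)
  rw [Finset.sum_range_succ] at h
  have h0 : sortedValue k m p01 p11 1 0 ω = 0 := rfl
  rw [h0, add_zero] at h
  rw [← h, add_div, relativeValue]

theorem MyopicData.abs_sortedValue_sub_le (hd : MyopicData k m p01 p11 1 r R D) (hkN : k ≤ N)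
    (n : ℕ) {ω : Fin N → I} (hω : ∀ i, ω i ∈ Set.Icc p01 p11) :
    |sortedValue k m p01 p11 1 n ω -
      listValue k m p01 p11 1 n (List.replicate N (p01 : ℝ))| ≤ N * D := by
  have h := hd.abs_sub_replicate_le n (u := []) (l := sortedBeliefs ω) (by simp)
    (fun x hx => by obtain ⟨i, rfl⟩ := mem_sortedBeliefs ω hx; exact hω i)
    (by rw [length_sortedBeliefs]; simpa using hkN)
  rw [length_sortedBeliefs] at h
  exact h

theorem MyopicData.lookahead_le (hd : MyopicData k m p01 p11 1 r R D) (hkN : k ≤ N) (n : ℕ)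
    {ω : Fin N → I} (hω : ∀ i, ω i ∈ Set.Icc p01 p11) {s : Finset (Fin N)} (hs : s.card = k) :
    lookahead m p01 p11 (relativeValue k m p01 p11 n) ω s ≤ relativeValue k m p01 p11 n ω +
      (listValue k m p01 p11 1 (n + 1) (List.replicate N (p01 : ℝ)) + N * D) / (n + 1 : ℕ) := by
  rw [lookahead_relativeValue]
  calc _ ≤ (∑ j ∈ Finset.range (n + 1), sortedValue k m p01 p11 1 (j + 1) ω) / (n + 1 : ℕ) :=
        div_le_div_of_nonneg_right
          (Finset.sum_le_sum fun j _ => hd.bellman_le hkN j hω hs) (Nat.cast_nonneg _)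
    _ ≤ _ := by
        rw [sum_sortedValue_succ]
        gcongr
        linarith [(abs_le.1 (hd.abs_sortedValue_sub_le hkN (n + 1) hω)).2]

theorem MyopicData.le_lookahead (hd : MyopicData k m p01 p11 1 r R D) (hkN : k ≤ N) (n : ℕ)
    {ω : Fin N → I} (hω : ∀ i, ω i ∈ Set.Icc p01 p11) {s : Finset (Fin N)} (hs : s.card = k)
    (hmax : ∀ i ∈ s, ∀ j ∉ s, ω j ≤ ω i) :
    relativeValue k m p01 p11 n ω +
      (listValue k m p01 p11 1 (n + 1) (List.replicate N (p01 : ℝ)) - N * D) / (n + 1 : ℕ) ≤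
      lookahead m p01 p11 (relativeValue k m p01 p11 n) ω s := by
  rw [lookahead_relativeValue]
  simp only [hd.bellman_eq _ ω hs hmax]
  rw [sum_sortedValue_succ]
  gcongr
  linarith [(abs_le.1 (hd.abs_sortedValue_sub_le hkN (n + 1) hω)).1]

/-- For every `n`, any policy has average at most `(G n + N D) / (n + 1)` and the myopic one at
least `(G n - N D) / (n + 1)`. The gap tends to zero, so convergence of `G n / (n + 1)` need not be
proved beforehand. -/
theorem MyopicData.isAverageOptimal (hd : MyopicData k m p01 p11 1 r R D) (hkN : k ≤ N)
    {π : Policy N k} (hπ : IsMyopic π) (ω : Fin N → I) : IsAverageOptimal m p01 p11 π ω := by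
  have hp : p01 ≤ p11 := hd.hpq
  set G : ℕ → ℝ := fun n => listValue k m p01 p11 1 (n + 1) (List.replicate N (p01 : ℝ))
  have hupper : ∀ (π' : Policy N k) (n : ℕ), ∀ᵐ x ∂(channelLaw p01 p11 ω),
      limsup (timeAverage m p01 p11 π' ω x) atTop ≤ (G n + N * D) / (n + 1 : ℕ) := fun π' n =>
    ae_limsup_timeAverage_le hp (relativeValue_mem hp n) π'
      (fun t ω hω => hd.lookahead_le hkN n hω (π' t ω).2) ω
  have hlower : ∀ n : ℕ, ∀ᵐ x ∂(channelLaw p01 p11 ω),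
      (G n - N * D) / (n + 1 : ℕ) ≤ liminf (timeAverage m p01 p11 π ω x) atTop := fun n =>
    ae_le_liminf_timeAverage hp (relativeValue_mem hp n) π
      (fun t ω hω => hd.le_lookahead hkN n hω (π t ω).2 (hπ t ω)) ω
  have hgap : Tendsto (fun n : ℕ => 2 * (N * D) / ((n + 1 : ℕ) : ℝ)) atTop (𝓝 0) :=
    (tendsto_add_atTop_iff_nat 1).2 (tendsto_const_div_atTop_nhds_zero_nat (2 * (N * D)))
  have hsplit : ∀ n : ℕ, (G n + N * D) / ((n + 1 : ℕ) : ℝ) =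
      (G n - N * D) / ((n + 1 : ℕ) : ℝ) + 2 * (N * D) / ((n + 1 : ℕ) : ℝ) := by
    intro n
    rw [← add_div]
    ring
  constructor
  · filter_upwards [ae_all_iff.2 (hupper π), ae_all_iff.2 hlower] with x hu hl
    refine ⟨liminf (timeAverage m p01 p11 π ω x) atTop,
      tendsto_of_le_liminf_of_limsup_le le_rfl ?_ (isBoundedUnder_le_timeAverage π ω x)
        (isBoundedUnder_ge_timeAverage π ω x)⟩
    rw [← sub_nonpos]
    refine ge_of_tendsto' hgap fun n => ?_
    have := hu n
    rw [hsplit] at this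
    linarith [hl n]
  · intro π'
    rw [← sub_nonpos]
    refine ge_of_tendsto' hgap fun n => ?_
    have h1 : averageValue m p01 p11 π' ω ≤ (G n + N * D) / (n + 1 : ℕ) := by
      have := integral_mono_ae (integrable_limsup_timeAverage π' ω) (integrable_const _)
        (hupper π' n)
      simpa [averageValue] using this
    have h2 : (G n - N * D) / (n + 1 : ℕ) ≤ averageValue m p01 p11 π ω := by
      have hle : ∀ᵐ x ∂(channelLaw p01 p11 ω), (G n - N * D) / (n + 1 : ℕ) ≤
          limsup (timeAverage m p01 p11 π ω x) atTop := by
        filter_upwards [hlower n] with x hx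
        exact hx.trans (liminf_le_limsup (isBoundedUnder_le_timeAverage π ω x)
          (isBoundedUnder_ge_timeAverage π ω x))
      have := integral_mono_ae (integrable_const _) (integrable_limsup_timeAverage π ω) hle
      simpa [averageValue] using this
    rw [hsplit] at h1
    linarith

end Poisson

end

end ChannelSensing

theorem mainTheorem3 (N k m : ℕ) (hm : 1 ≤ m) (hmk : m ≤ k) (hkN : k ≤ N)
    (p01 p11 : unitInterval) (hp : p01 ≤ p11) (hδ : (p11 : ℝ) - p01 < 1)
    (hcond : ((p11 : ℝ) - p01) / (1 - ((p11 : ℝ) - p01)) <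
      ChannelSensing.Rmin N k m p01 p11 / ChannelSensing.Rmax N k m p01 p11)
    (πg : ChannelSensing.Policy N k) (hπg : ChannelSensing.IsMyopic πg) :
    (∀ β : ℝ, 0 < β → β < 1 → ∀ ω : Fin N → unitInterval, (∀ i, ω i ∈ Set.Icc p01 p11) →
      ChannelSensing.IsDiscountedOptimal m p01 p11 β πg ω) ∧
    (∀ ω : Fin N → unitInterval, ChannelSensing.IsAverageOptimal m p01 p11 πg ω) := by
  -- The data hold for all `β` in `[0, 1]`; the endpoint `β = 1` serves the average-reward problem.
  have hd := fun {β : ℝ} (hβ : 0 ≤ β) (hβ1 : β ≤ 1) =>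
    ChannelSensing.myopicData_of_lt m hkN p01 p11 hp hδ hcond hβ hβ1
  exact ⟨fun β hβ hβ1 ω hω => (hd hβ.le hβ1.le).isDiscountedOptimal hkN hβ hβ1 hπg hω,
    fun ω => (hd zero_le_one le_rfl).isAverageOptimal hkN hπg ω⟩
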